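/- Let $n\ge 1$, let $\mathcal M\subset M_n(\mathbb C)$ be a unital $*$-subalgebra and let $\sigma\in\mathcal M$ be a full-rank density matrix (positive, $\mathrm{tr}(\sigma)=1$, $\operatorname{rank}\sigma=n$). A quantum Markov semigroup (QMS) on a unital $*$-subalgebra $\mathcal N\subset M_n(\mathbb C)$ is a family $(P_t)_{t\ge 0}$ of unital completely positive linear maps on $\mathcal N$ with $P_0=\mathrm{id}$, $P_sP_t=P_{s+t}$ for $s,t\ge 0$ and $P_t(x)\to x$ as $t\searrow 0$ for all $x\in\mathcal N$; it satisfies the $\sigma$-detailed balance condition ($\sigma$-DBC) if $\mathrm{tr}(P_t(x)^*y\sigma)=\mathrm{tr}(x^*P_t(y)\sigma)$ for all $t\ge 0$ and $x,y\in\mathcal N$. Its generator is $\mathcal L(x)=\lim_{t\searrow 0}\frac1t(x-P_t(x))$. If $(P_t)$ is a QMS on $\mathcal M$ satisfying the $\sigma$-DBC, then there is a QMS $(\hat P_t)$ on $M_n(\mathbb C)$ satisfying the $\sigma$-DBC with $\hat P_t(x)=P_t(x)$ for all $t\ge 0$ and $x\in\mathcal M$. In particular, there exist a finite set $\mathcal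 J$, real numbers $\omega_j$, positive numbers $c_j$ and elements $v_j\in M_n(\mathbb C)$ for $j\in\mathcal J$ with 1. $\mathrm{tr}(v_j)=0$ for all $j\in\mathcal J$, 2. $\mathrm{tr}(v_j^*v_k)=\delta_{jk}$ for all $j,k\in\mathcal J$, 3. $\{v_j\mid j\in\mathcal J\}=\{v_j^*\mid j\in\mathcal J\}$, 4. $\sigma v_j\sigma^{-1}=e^{-\omega_j}v_j$ for all $j\in\mathcal J$ such that the generator $\mathcal L$ of $(P_t)$ exists and satisfies, for all $x\in\mathcal M$, $$\mathcal L(x)=\sum_{j\in\mathcal J}c_j\left(e^{-\omega_j/2}\,v_j^*[v_j,x]-e^{\omega_j/2}\,[v_j,x]\,v_j^*\right).$$ -/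

import Mathlib

open Filter
open scoped NNReal Topology Matrix ComplexOrder

/-- A density matrix: a positive (semidefinite) matrix with trace `1`. -/
structure IsDensityMatrix {n : ℕ} (σ : Matrix (Fin n) (Fin n) ℂ) : Prop where
  posSemidef : σ.PosSemidef
  trace_eq_one : σ.trace = 1

/-- A linear map `P` on a unital `*`-subalgebra `M` of `M_n(ℂ)` is completely positive if for all `k`
the entrywise map `id ⊗ P` on `M_k(M)` preserves positivity, where `M_k(M)` is regarded as a
`*`-subalgebra of `M_k(M_n(ℂ)) = M_{kn}(ℂ)` (the identification is `Matrix.comp`). -/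
def IsCompletelyPositive {n : ℕ} {M : StarSubalgebra ℂ (Matrix (Fin n) (Fin n) ℂ)}
    (P : M →ₗ[ℂ] M) : Prop :=
  ∀ (k : ℕ) (X : Matrix (Fin k) (Fin k) M),
    (Matrix.comp (Fin k) (Fin k) (Fin n) (Fin n) ℂ
      (X.map fun x => (x : Matrix (Fin n) (Fin n) ℂ))).PosSemidef →
    (Matrix.comp (Fin k) (Fin k) (Fin n) (Fin n) ℂ
      (X.map fun x => (P x : Matrix (Fin n) (Fin n) ℂ))).PosSemidef

/-- A quantum Markov semigroup on a unital `*`-subalgebra `M` of `M_n(ℂ)`. Since `M` is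
finite-dimensional, every linear map on `M` is normal, and weak convergence is convergence in the
(unique) vector space topology of `M`. -/
structure IsQuantumMarkovSemigroup {n : ℕ} {M : StarSubalgebra ℂ (Matrix (Fin n) (Fin n) ℂ)}
    (P : ℝ≥0 → M →ₗ[ℂ] M) : Prop where
  map_one : ∀ t, P t 1 = 1
  completelyPositive : ∀ t, IsCompletelyPositive (P t)
  zero : P 0 = LinearMap.id
  add : ∀ s t, P s ∘ₗ P t = P (s + t)
  tendsto_zero : ∀ x : M, Tendsto (fun t : ℝ≥0 => P t x) (𝓝[>] 0) (𝓝 x)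

/-- The `σ`-detailed balance condition: every `P t` is GNS-symmetric with respect to the
functional `φ = tr(· σ)`, that is, `φ((P t x)^* y) = φ(x^* (P t y))`. -/
def SatisfiesDBC {n : ℕ} {M : StarSubalgebra ℂ (Matrix (Fin n) (Fin n) ℂ)}
    (σ : Matrix (Fin n) (Fin n) ℂ) (P : ℝ≥0 → M →ₗ[ℂ] M) : Prop :=
  ∀ (t : ℝ≥0) (x y : M),
    ((P t x : Matrix (Fin n) (Fin n) ℂ)ᴴ * (y : Matrix (Fin n) (Fin n) ℂ) * σ).trace =
      ((x : Matrix (Fin n) (Fin n) ℂ)ᴴ * (P t y : Matrix (Fin n) (Fin n) ℂ) * σ).trace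

/-- `L` is the generator of `P`, with the sign convention `L x = lim_{t ↘ 0} (x - P t x) / t`. -/
def IsGenerator {n : ℕ} {M : StarSubalgebra ℂ (Matrix (Fin n) (Fin n) ℂ)}
    (P : ℝ≥0 → M →ₗ[ℂ] M) (L : M →ₗ[ℂ] M) : Prop :=
  ∀ x : M, Tendsto (fun t : ℝ≥0 => (((t : ℝ) : ℂ))⁻¹ • (x - P t x)) (𝓝[>] 0) (𝓝 (L x))

/-!
Let `L` be the generator of a semigroup on `M ⊆ M_n(ℂ)` with `σ`-detailed balance, and put `G = -L`.

*Extension.* Conditional complete positivity of `G` makes it possible to write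
`G x = k x + x k + Φ x` on `M` with `Φ` completely positive. The coefficient `k` is an average of
`G(u) u*` over `M`, corrected by a central term; the average is taken against the Casimir element
`∑ x ⊗ x*` of an orthonormal basis of `M` for the trace form (`IsStarBasis.casimir_left`,
`IsStarBasis.gramForm_sub_drift_nonneg`). Because the average is canonical, it inherits the
symmetries of `G`: `G` commutes with the modular operator `x ↦ σ x σ⁻¹`, so `k` commutes with `σ`
(`IsStarBasis.drift_comm`), and then detailed balance gives that `k` is self-adjoint
(`IsStarBasis.drift_conjTranspose`). Since `σ ∈ M`, the trace preserving conditional expectation `E`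
onto `M` also preserves `tr (· σ)`, so `x ↦ k x + x k + Φ (E x)` satisfies detailed balance on all
matrices and extends `G` (`IsDetailedBalanceGenerator.exists_form`). Its exponential is completely
positive because the Euler steps can be taken of the form `x ↦ (1 + s k) x (1 + s k) + s Φ (E x)`,
up to an error of second order (`tendsto_pow_exp`, `IsDetailedBalanceForm.isCPMap_exp`).

*Form of the generator.* The completely positive part `Ψ = Φ ∘ E` is encoded by the operator
`reshuffle Ψ` on matrices, for which a map `x ↦ ∑ d v* x v` becomes `∑ d |v⟩⟨v|`. This operator is
positive, commutes with the modular operator, and is intertwined with the adjoint up to the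
inverse modular operator (`reshuffle_nonneg`, `reshuffle_modular`, `reshuffle_conjTranspose`). These
properties persist after compression to the matrices of trace `0`, which only changes `k`. A
spectral theorem adapted to these symmetries (`exists_isStarBasis_eigenvectors`) provides an
orthonormal family of joint eigenvectors closed under adjoints; these are the `v j`. Finally,
`k` is determined by `Ψ` through `G 1 = 0`, and pairing `v` with `v*` turns the result into the commutator form
(`IsDetailedBalanceForm.exists_alicki`).

*Existence of the generator.* In finite dimensions the semigroup is norm continuous, and a norm
continuous semigroup is the exponential of a bounded generator (`exists_eq_exp_of_semigroup`).
-/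

section Matrices

variable {n : ℕ}

local notation "𝕄" => Matrix (Fin n) (Fin n) ℂ

/-! ### The trace form on matrices -/

section TraceForm

theorem trace_conjTranspose_mul_comm (x y : 𝕄) : star (xᴴ * y).trace = (yᴴ * x).trace := by
  rw [← Matrix.trace_conjTranspose, Matrix.conjTranspose_mul, Matrix.conjTranspose_conjTranspose]

theorem trace_conjTranspose_mul_self_nonneg (x : 𝕄) : 0 ≤ (xᴴ * x).trace :=
  (Matrix.posSemidef_conjTranspose_mul_self x).trace_nonneg

theorem trace_conjTranspose_mul_self_pos {x : 𝕄} (hx : x ≠ 0) : 0 < (xᴴ * x).trace :=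
  lt_of_le_of_ne (trace_conjTranspose_mul_self_nonneg x)
    fun h => hx (Matrix.trace_conjTranspose_mul_self_eq_zero_iff.1 h.symm)

theorem eq_of_trace_mul_eq {x y : 𝕄} (h : ∀ z : 𝕄, (z * x).trace = (z * y).trace) : x = y := by
  rw [← sub_eq_zero, ← Matrix.trace_conjTranspose_mul_self_eq_zero_iff, mul_sub, Matrix.trace_sub,
    h, sub_self]

/-- Every nonzero matrix has a positive multiple that is a unit vector for the trace form. -/
theorem exists_pos_smul_unit {x : 𝕄} (hx : x ≠ 0) :
    ∃ r : ℝ, 0 < r ∧ (((r : ℂ) • x)ᴴ * ((r : ℂ) • x)).trace = 1 := by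
  have h := trace_conjTranspose_mul_self_pos hx
  obtain ⟨s, hs⟩ : ∃ s : ℝ, (s : ℂ) = (xᴴ * x).trace :=
    ⟨_, (Complex.eq_re_of_ofReal_le (r := 0) (by simpa using h.le)).symm⟩
  rw [← hs] at h
  have h0 : 0 < s := by exact_mod_cast h
  refine ⟨(Real.sqrt s)⁻¹, by positivity, ?_⟩
  rw [Matrix.conjTranspose_smul, Matrix.smul_mul, Matrix.mul_smul, smul_smul, Matrix.trace_smul,
    ← hs, Complex.star_def, Complex.conj_ofReal, smul_eq_mul]
  norm_cast
  rw [← mul_inv, Real.mul_self_sqrt h0.le, inv_mul_cancel₀ h0.ne']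

theorem isUnit_det_of_posDef {σ : 𝕄} (hσ : σ.PosDef) : IsUnit σ.det :=
  (Matrix.isUnit_iff_isUnit_det _).1 hσ.isUnit

/-- The modular eigenvalue of an eigenvector is positive. -/
theorem modular_eigenvalue_pos {σ : 𝕄} (hσ : σ.PosDef) {v : 𝕄} (hv : v ≠ 0) {δ : ℂ}
    (h : σ * v * σ⁻¹ = δ • v) : ∃ r : ℝ, 0 < r ∧ δ = r := by
  have hu := isUnit_det_of_posDef hσ
  have h1 : σ * v = δ • (v * σ) := by
    rw [← Matrix.smul_mul, ← h, Matrix.mul_assoc (σ * v), Matrix.nonsing_inv_mul _ hu,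
      Matrix.mul_one]
  have h2 : 0 < (vᴴ * σ * v).trace := by
    refine lt_of_le_of_ne (hσ.posSemidef.conjTranspose_mul_mul_same v).trace_nonneg fun h0 => hv ?_
    have h3 := (hσ.posSemidef.conjTranspose_mul_mul_same v).trace_eq_zero_iff.1 h0.symm
    have h4 : σ * v = 0 := by
      ext i j
      have h5 : star (fun k => v k j) ⬝ᵥ (σ *ᵥ fun k => v k j) = 0 := by
        have := congrFun (congrFun h3 j) j
        rw [Matrix.mul_assoc] at this
        simpa [Matrix.mul_apply, dotProduct, Matrix.mulVec] using this
      have := congrFun ((hσ.posSemidef.dotProduct_mulVec_zero_iff _).1 h5) i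
      simpa [Matrix.mul_apply, dotProduct, Matrix.mulVec] using this
    calc v = σ⁻¹ * (σ * v) := (Matrix.nonsing_inv_mul_cancel_left _ _ hu).symm
      _ = 0 := by rw [h4, Matrix.mul_zero]
  have h4 : (vᴴ * σ * v).trace = δ * (v * σ * vᴴ).trace := by
    rw [Matrix.mul_assoc, h1, Matrix.mul_smul, Matrix.trace_smul, smul_eq_mul,
      Matrix.trace_mul_comm]
  have h3 : 0 < (v * σ * vᴴ).trace := by
    refine lt_of_le_of_ne (hσ.posSemidef.mul_mul_conjTranspose_same v).trace_nonneg fun h0 => ?_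
    rw [← h0, mul_zero] at h4
    exact h2.ne' h4
  have h5 : δ = (vᴴ * σ * v).trace * (v * σ * vᴴ).trace⁻¹ := by
    rw [h4, mul_assoc, mul_inv_cancel₀ h3.ne', mul_one]
  have h6 : 0 < δ := by
    rw [h5]; exact mul_pos h2 (by
      rw [Complex.pos_iff] at h3 ⊢
      rw [Complex.inv_re, Complex.inv_im, ← h3.2]
      refine ⟨div_pos h3.1 (Complex.normSq_pos.2 fun h => ?_), by simp⟩
      rw [h] at h3; simp at h3)
  exact ⟨δ.re, (Complex.pos_iff.1 h6).1,
    Complex.ext rfl (by simpa using (Complex.pos_iff.1 h6).2.symm)⟩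

/-- Two commuting endomorphisms have a common eigenvector in every nonzero invariant subspace. -/
theorem exists_joint_eigenvector {V : Type*} [AddCommGroup V] [Module ℂ V] [FiniteDimensional ℂ V]
    (A B : V →ₗ[ℂ] V) (hAB : ∀ v, A (B v) = B (A v)) (H : Submodule ℂ V) (hH : H ≠ ⊥)
    (hA : ∀ v ∈ H, A v ∈ H) (hB : ∀ v ∈ H, B v ∈ H) :
    ∃ v ∈ H, v ≠ 0 ∧ (∃ a : ℂ, A v = a • v) ∧ ∃ b : ℂ, B v = b • v := by
  have eig : ∀ (C : V →ₗ[ℂ] V) (N : Submodule ℂ V), N ≠ ⊥ → (∀ v ∈ N, C v ∈ N) →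
      ∃ v ∈ N, v ≠ 0 ∧ ∃ c : ℂ, C v = c • v := by
    intro C N hN hC
    have : Nontrivial N := Submodule.nontrivial_iff_ne_bot.2 hN
    obtain ⟨c, hc⟩ := Module.End.exists_eigenvalue (C.restrict hC)
    obtain ⟨w, hw⟩ := hc.exists_hasEigenvector
    refine ⟨w, w.2, fun h => hw.2 (Subtype.ext h), c, ?_⟩
    simpa using congrArg Subtype.val hw.apply_eq_smul
  obtain ⟨v, hv, hv0, a, ha⟩ := eig A H hH hA
  obtain ⟨w, hw, hw0, b, hb⟩ := eig B (H ⊓ LinearMap.ker (A - a • LinearMap.id))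
    (fun h => hv0 ((Submodule.mem_bot ℂ).1 (h ▸ ⟨hv, by simp [ha]⟩)))
    (fun x hx => ⟨hB x hx.1, by
      have : A x = a • x := by simpa [sub_eq_zero] using hx.2
      simp [hAB, this]⟩)
  exact ⟨w, hw.1, hw0, ⟨a, by simpa [sub_eq_zero] using hw.2⟩, b, hb⟩

/-- A finite family of trace-orthonormal matrices, closed under adjoints, spanning the
subspace `H`. -/
structure IsStarBasis (H : Submodule ℂ 𝕄) (S : Finset 𝕄) : Prop where
  mem : ∀ v ∈ S, v ∈ H
  orthonormal : ∀ v ∈ S, ∀ w ∈ S, (vᴴ * w).trace = if v = w then 1 else 0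
  star_mem : ∀ v ∈ S, vᴴ ∈ S
  expand : ∀ y ∈ H, y = ∑ v ∈ S, (vᴴ * y).trace • v

end TraceForm

/-! ### Star closed orthonormal bases of eigenvectors -/

section StarBasis

/-- A trace-symmetric operator has real eigenvalues. -/
theorem star_eigenvalue_of_symmetric {T : 𝕄 →ₗ[ℂ] 𝕄}
    (hT : ∀ x y, ((T x)ᴴ * y).trace = (xᴴ * T y).trace) {v : 𝕄} (hv : v ≠ 0) {d : ℂ}
    (h : T v = d • v) : star d = d := by
  have h1 := hT v v
  rw [h, Matrix.conjTranspose_smul, Matrix.smul_mul, Matrix.mul_smul, Matrix.trace_smul,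
    Matrix.trace_smul, smul_eq_mul, smul_eq_mul] at h1
  exact mul_right_cancel₀ (trace_conjTranspose_mul_self_pos hv).ne' h1

/-- Adjoints of modular eigenvectors are modular eigenvectors for the inverse eigenvalue. -/
theorem modular_conjTranspose {σ : 𝕄} (hσ : σ.PosDef) {v : 𝕄} {r : ℝ} (hr : r ≠ 0)
    (h : σ * v * σ⁻¹ = (r : ℂ) • v) :
    σ * vᴴ * σ⁻¹ = ((r⁻¹ : ℝ) : ℂ) • vᴴ ∧ σ⁻¹ * v * σ = ((r⁻¹ : ℝ) : ℂ) • v := by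
  have hu := isUnit_det_of_posDef hσ
  have hi := Matrix.nonsing_inv_mul _ hu
  have hi' := Matrix.mul_nonsing_inv _ hu
  have hr' : (r : ℂ) ≠ 0 := by exact_mod_cast hr
  have key : σ⁻¹ * v * σ = ((r⁻¹ : ℝ) : ℂ) • v := by
    have : σ⁻¹ * (σ * v * σ⁻¹) * σ = v := by
      rw [← Matrix.mul_assoc, ← Matrix.mul_assoc, hi, Matrix.one_mul, Matrix.mul_assoc, hi,
        Matrix.mul_one]
    rw [h, Matrix.mul_smul, Matrix.smul_mul] at this
    rw [← this, smul_smul, this, Complex.ofReal_inv, inv_mul_cancel₀ hr', one_smul]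
  refine ⟨?_, key⟩
  have h2 := congrArg Matrix.conjTranspose key
  rwa [Matrix.conjTranspose_mul, Matrix.conjTranspose_mul, Matrix.conjTranspose_nonsing_inv,
    hσ.isHermitian.eq, Matrix.conjTranspose_smul, Complex.star_def, Complex.conj_ofReal,
    ← Matrix.mul_assoc] at h2

/-- A nonzero subspace invariant under `T`, the modular operator and the adjoint contains a
nonempty orthonormal family of joint eigenvectors that is closed under adjoints. A joint
eigenvector with modular eigenvalue `≠ 1` is orthogonal to its adjoint; one with modular
eigenvalue `1` may be replaced by a Hermitian one. -/
theorem exists_star_closed_eigenvectors {σ : 𝕄} (hσ : σ.PosDef) (T : 𝕄 →ₗ[ℂ] 𝕄)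
    (hT : ∀ x y, ((T x)ᴴ * y).trace = (xᴴ * T y).trace)
    (hTσ : ∀ y, T (σ * y * σ⁻¹) = σ * T y * σ⁻¹)
    (hTs : ∀ y, T yᴴ = (T (σ⁻¹ * y * σ))ᴴ)
    (H : Submodule ℂ 𝕄) (hH : H ≠ ⊥) (hTH : ∀ y ∈ H, T y ∈ H)
    (hσH : ∀ y ∈ H, σ * y * σ⁻¹ ∈ H) (hsH : ∀ y ∈ H, yᴴ ∈ H) :
    ∃ B : Finset 𝕄, B.Nonempty ∧ (∀ v ∈ B, v ∈ H) ∧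
      (∀ v ∈ B, ∀ w ∈ B, (vᴴ * w).trace = if v = w then 1 else 0) ∧ (∀ v ∈ B, vᴴ ∈ B) ∧
      (∀ v ∈ B, ∃ d : ℂ, T v = d • v) ∧
      (∀ v ∈ B, ∃ r : ℝ, 0 < r ∧ σ * v * σ⁻¹ = (r : ℂ) • v) := by
  classical
  have hu := isUnit_det_of_posDef hσ
  have hi := Matrix.nonsing_inv_mul _ hu
  obtain ⟨v, hvH, hv0, ⟨d, hd⟩, δ, hδ⟩ := exists_joint_eigenvector T
    (LinearMap.mulRight ℂ σ⁻¹ ∘ₗ LinearMap.mulLeft ℂ σ) (by simpa using hTσ) H hH hTH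
    (by simpa using hσH)
  replace hδ : σ * v * σ⁻¹ = δ • v := by simpa using hδ
  obtain ⟨r, hr, rfl⟩ := modular_eigenvalue_pos hσ hv0 hδ
  have hTv : T vᴴ = ((r⁻¹ : ℝ) * d) • vᴴ := by
    rw [hTs, (modular_conjTranspose hσ hr.ne' hδ).2, map_smul, hd, smul_smul,
      Matrix.conjTranspose_smul, star_mul, star_eigenvalue_of_symmetric hT hv0 hd,
      Complex.star_def, Complex.conj_ofReal, mul_comm]
  by_cases h1 : r = 1
  · subst h1
    obtain ⟨u, hu0, huH, hus, ⟨c, hc⟩, hum⟩ : ∃ u : 𝕄, u ≠ 0 ∧ u ∈ H ∧ uᴴ = u ∧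
        (∃ c : ℂ, T u = c • u) ∧ σ * u * σ⁻¹ = u := by
      by_cases hs : v + vᴴ = 0
      · have hs' : vᴴ = -v := eq_neg_of_add_eq_zero_right hs
        refine ⟨Complex.I • v, smul_ne_zero Complex.I_ne_zero hv0, H.smul_mem _ hvH, ?_,
          ⟨d, ?_⟩, ?_⟩
        · rw [Matrix.conjTranspose_smul, hs', Complex.star_def, Complex.conj_I, smul_neg, neg_smul,
            neg_neg]
        · rw [map_smul, hd, smul_comm]
        · rw [Matrix.mul_smul, Matrix.smul_mul, hδ, Complex.ofReal_one, one_smul]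
      · refine ⟨v + vᴴ, hs, H.add_mem hvH (hsH v hvH), ?_, ⟨d, ?_⟩, ?_⟩
        · rw [Matrix.conjTranspose_add, Matrix.conjTranspose_conjTranspose, add_comm]
        · rw [map_add, hd, hTv, smul_add]; simp
        · rw [Matrix.mul_add, Matrix.add_mul, hδ, (modular_conjTranspose hσ one_ne_zero hδ).1]
          simp
    obtain ⟨s, hs0, hs⟩ := exists_pos_smul_unit hu0
    refine ⟨{(s : ℂ) • u}, by simp, ?_, ?_, ?_, ?_, ?_⟩
    · simp only [Finset.mem_singleton, forall_eq]
      exact H.smul_mem _ huH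
    · simpa using hs
    · simp [hus]
    · simp only [Finset.mem_singleton, forall_eq]
      exact ⟨c, by rw [map_smul, hc, smul_comm]⟩
    · simp only [Finset.mem_singleton, forall_eq]
      exact ⟨1, one_pos, by rw [Matrix.mul_smul, Matrix.smul_mul, hum]; simp⟩
  · obtain ⟨s, hs0, hs⟩ := exists_pos_smul_unit hv0
    set u := (s : ℂ) • v with hu_def
    have hδu : σ * u * σ⁻¹ = (r : ℂ) • u := by
      rw [hu_def, Matrix.mul_smul, Matrix.smul_mul, hδ, smul_comm]
    have hus : uᴴ = (s : ℂ) • vᴴ := by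
      rw [hu_def, Matrix.conjTranspose_smul, Complex.star_def, Complex.conj_ofReal]
    have hs' : (uᴴᴴ * uᴴ).trace = 1 := by
      rw [Matrix.conjTranspose_conjTranspose, Matrix.trace_mul_comm, hs]
    have hmod : ∀ w : 𝕄, σ * w * σ⁻¹ = (r : ℂ) • w → (w * w).trace = 0 := by
      intro w hw
      have h2 : (w * w).trace = (r : ℂ) ^ 2 * (w * w).trace := by
        calc (w * w).trace = (σ * w * σ⁻¹ * (σ * w * σ⁻¹)).trace := by
              rw [show σ * w * σ⁻¹ * (σ * w * σ⁻¹) = σ * w * (σ⁻¹ * σ) * w * σ⁻¹ by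
                simp only [Matrix.mul_assoc], hi, Matrix.mul_one, Matrix.trace_mul_comm (σ * w * w),
                Matrix.mul_assoc σ, Matrix.nonsing_inv_mul_cancel_left _ _ hu]
          _ = _ := by
              rw [hw, Matrix.smul_mul, Matrix.mul_smul, smul_smul, Matrix.trace_smul, smul_eq_mul,
                sq]
      by_contra h3
      have h4 : (r : ℂ) ^ 2 = 1 := (mul_eq_right₀ h3).1 h2.symm
      have h5 : r ^ 2 = 1 := by exact_mod_cast h4
      exact h1 (by nlinarith)
    have ho1 : (uᴴᴴ * u).trace = 0 := by rw [Matrix.conjTranspose_conjTranspose, hmod u hδu]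
    have ho2 : (uᴴ * uᴴ).trace = 0 := by
      rw [← Matrix.conjTranspose_mul, Matrix.trace_conjTranspose, hmod u hδu, star_zero]
    have hne : u ≠ uᴴ := fun h => by
      rw [← h] at ho2; rw [← h, ho2] at hs; exact zero_ne_one hs
    refine ⟨{u, uᴴ}, by simp, ?_, ?_, ?_, ?_, ?_⟩
    · simp only [Finset.mem_insert, Finset.mem_singleton, forall_eq_or_imp, forall_eq]
      exact ⟨H.smul_mem _ hvH, hsH _ (H.smul_mem _ hvH)⟩
    · simp only [Finset.mem_insert, Finset.mem_singleton, forall_eq_or_imp, forall_eq]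
      exact ⟨⟨by rw [hs]; simp, by rw [ho2, if_neg hne]⟩, by rw [ho1, if_neg hne.symm],
        by rw [hs']; simp⟩
    · simp
    · simp only [Finset.mem_insert, Finset.mem_singleton, forall_eq_or_imp, forall_eq]
      exact ⟨⟨d, by rw [hu_def, map_smul, hd, smul_comm]⟩,
        ⟨_, by rw [hus, map_smul, hTv, smul_comm]⟩⟩
    · simp only [Finset.mem_insert, Finset.mem_singleton, forall_eq_or_imp, forall_eq]
      exact ⟨⟨r, hr, hδu⟩, r⁻¹, inv_pos.2 hr, (modular_conjTranspose hσ hr.ne' hδu).1⟩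

/-- The spectral theorem for a trace-symmetric operator commuting with the modular operator and
intertwining it with the adjoint: every invariant subspace has a star closed orthonormal basis of
joint eigenvectors. -/
theorem exists_isStarBasis_eigenvectors {σ : 𝕄} (hσ : σ.PosDef) (T : 𝕄 →ₗ[ℂ] 𝕄)
    (hT : ∀ x y, ((T x)ᴴ * y).trace = (xᴴ * T y).trace)
    (hTσ : ∀ y, T (σ * y * σ⁻¹) = σ * T y * σ⁻¹)
    (hTs : ∀ y, T yᴴ = (T (σ⁻¹ * y * σ))ᴴ)
    (H : Submodule ℂ 𝕄) (hTH : ∀ y ∈ H, T y ∈ H)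
    (hσH : ∀ y ∈ H, σ * y * σ⁻¹ ∈ H) (hsH : ∀ y ∈ H, yᴴ ∈ H) :
    ∃ S : Finset 𝕄, IsStarBasis H S ∧ (∀ v ∈ S, ∃ d : ℂ, T v = d • v) ∧
      (∀ v ∈ S, ∃ r : ℝ, 0 < r ∧ σ * v * σ⁻¹ = (r : ℂ) • v) := by
  classical
  induction hN : Module.finrank ℂ H using Nat.strong_induction_on generalizing H with
  | _ N ih =>
  by_cases hH : H = ⊥
  · refine ⟨∅, ⟨by simp, by simp, by simp, fun y hy => ?_⟩, by simp, by simp⟩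
    simpa [hH] using hy
  obtain ⟨B, ⟨b, hb⟩, hBH, hBo, hBs, hBT, hBσ⟩ :=
    exists_star_closed_eigenvectors hσ T hT hTσ hTs H hH hTH hσH hsH
  have hu := isUnit_det_of_posDef hσ
  have hσsym : ∀ x y : 𝕄, (xᴴ * (σ * y * σ⁻¹)).trace = ((σ * x * σ⁻¹)ᴴ * y).trace := by
    intro x y
    rw [Matrix.conjTranspose_mul, Matrix.conjTranspose_mul, Matrix.conjTranspose_nonsing_inv,
      hσ.isHermitian.eq, ← Matrix.mul_assoc, Matrix.trace_mul_comm]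
    simp only [Matrix.mul_assoc]
  -- the orthogonal complement of `B` inside `H`
  let K : Submodule ℂ 𝕄 :=
    { carrier := {y | y ∈ H ∧ ∀ w ∈ B, (wᴴ * y).trace = 0}
      add_mem' := fun {x y} hx hy => ⟨H.add_mem hx.1 hy.1, fun w hw => by
        rw [mul_add, Matrix.trace_add, hx.2 w hw, hy.2 w hw, add_zero]⟩
      zero_mem' := ⟨H.zero_mem, fun w _ => by simp⟩
      smul_mem' := fun c x hx => ⟨H.smul_mem c hx.1, fun w hw => by
        rw [Matrix.mul_smul, Matrix.trace_smul, hx.2 w hw, smul_zero]⟩ }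
  have hK : ∀ y, y ∈ K ↔ y ∈ H ∧ ∀ w ∈ B, (wᴴ * y).trace = 0 := fun y => Iff.rfl
  have hlt : K < H := by
    refine lt_of_le_of_ne (fun y hy => hy.1) fun h => ?_
    have h1 := (h ▸ hBH b hb : b ∈ K).2 b hb
    rw [hBo b hb b hb, if_pos rfl] at h1
    exact one_ne_zero h1
  obtain ⟨S, hS, hST, hSσ⟩ := ih _ (hN ▸ Submodule.finrank_lt_finrank_of_lt hlt) K
    (fun y hy => ⟨hTH y hy.1, fun w hw => by
      obtain ⟨d, hd⟩ := hBT w hw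
      rw [← hT, hd, Matrix.conjTranspose_smul, Matrix.smul_mul, Matrix.trace_smul, hy.2 w hw,
        smul_zero]⟩)
    (fun y hy => ⟨hσH y hy.1, fun w hw => by
      obtain ⟨r, -, hr⟩ := hBσ w hw
      rw [hσsym, hr, Matrix.conjTranspose_smul, Matrix.smul_mul, Matrix.trace_smul, hy.2 w hw,
        smul_zero]⟩)
    (fun y hy => ⟨hsH y hy.1, fun w hw => by
      have := hy.2 _ (hBs w hw)
      rw [Matrix.conjTranspose_conjTranspose, Matrix.trace_mul_comm] at this
      rw [← Matrix.conjTranspose_mul, Matrix.trace_conjTranspose, this, star_zero]⟩) rfl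
  have hSB : ∀ v ∈ S, ∀ w ∈ B, (wᴴ * v).trace = 0 := fun v hv w hw => (hS.mem v hv).2 w hw
  have hBS : ∀ v ∈ S, ∀ w ∈ B, (vᴴ * w).trace = 0 := fun v hv w hw => by
    rw [← trace_conjTranspose_mul_comm, hSB v hv w hw, star_zero]
  have hdisj : Disjoint S B := Finset.disjoint_left.2 fun v hv hv' => by
    have := hSB v hv v hv'
    rw [hBo v hv' v hv', if_pos rfl] at this
    exact one_ne_zero this
  refine ⟨S ∪ B, ⟨?_, ?_, ?_, ?_⟩, ?_, ?_⟩
  · intro v hv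
    rcases Finset.mem_union.1 hv with h | h
    exacts [(hS.mem v h).1, hBH v h]
  · intro v hv w hw
    rcases Finset.mem_union.1 hv with h | h <;> rcases Finset.mem_union.1 hw with h' | h'
    · exact hS.orthonormal v h w h'
    · rw [hBS v h w h', if_neg (ne_of_mem_of_not_mem h (Finset.disjoint_right.1 hdisj h'))]
    · rw [hSB w h' v h, if_neg (ne_of_mem_of_not_mem h (Finset.disjoint_left.1 hdisj h'))]
    · exact hBo v h w h'
  · intro v hv
    rcases Finset.mem_union.1 hv with h | h
    exacts [Finset.mem_union_left _ (hS.star_mem v h), Finset.mem_union_right _ (hBs v h)]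
  · intro y hy
    rw [Finset.sum_union hdisj]
    set z := ∑ w ∈ B, (wᴴ * y).trace • w with hz
    have hzB : ∀ w ∈ B, (wᴴ * z).trace = (wᴴ * y).trace := by
      intro w hw
      rw [hz, Matrix.mul_sum, Matrix.trace_sum, Finset.sum_eq_single w]
      · rw [Matrix.mul_smul, Matrix.trace_smul, hBo w hw w hw, if_pos rfl, smul_eq_mul, mul_one]
      · intro w' hw' hne
        rw [Matrix.mul_smul, Matrix.trace_smul, hBo w hw w' hw', if_neg hne.symm, smul_zero]
      · exact fun h => absurd hw h
    have hzS : ∀ v ∈ S, (vᴴ * z).trace = 0 := by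
      intro v hv
      rw [hz, Matrix.mul_sum, Matrix.trace_sum]
      exact Finset.sum_eq_zero fun w hw => by
        rw [Matrix.mul_smul, Matrix.trace_smul, hBS v hv w hw, smul_zero]
    have hyz : y - z ∈ K := ⟨H.sub_mem hy (H.sum_mem fun w hw => H.smul_mem _ (hBH w hw)),
      fun w hw => by rw [mul_sub, Matrix.trace_sub, hzB w hw, sub_self]⟩
    have h1 := hS.expand _ hyz
    rw [sub_eq_iff_eq_add] at h1
    conv_lhs => rw [h1]
    congr 1
    exact Finset.sum_congr rfl fun v hv => by rw [mul_sub, Matrix.trace_sub, hzS v hv, sub_zero]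
  · intro v hv
    rcases Finset.mem_union.1 hv with h | h
    exacts [hST v h, hBT v h]
  · intro v hv
    rcases Finset.mem_union.1 hv with h | h
    exacts [hSσ v h, hBσ v h]

/-- Every star closed subspace of matrices has a star basis. -/
theorem exists_isStarBasis (H : Submodule ℂ 𝕄) (hsH : ∀ y ∈ H, yᴴ ∈ H) :
    ∃ S : Finset 𝕄, IsStarBasis H S := by
  obtain ⟨S, hS, -⟩ := exists_isStarBasis_eigenvectors (σ := (1 : 𝕄)) Matrix.PosDef.one
    LinearMap.id (by simp) (by simp) (by simp) H (by simp) (by simp) hsH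
  exact ⟨S, hS⟩

end StarBasis

/-! ### The Casimir element of a `*`-subalgebra -/

section Casimir

/-- The orthogonal projection, for the trace form, onto the span of an orthonormal family. For a
star basis of a `*`-subalgebra it is the trace preserving conditional expectation. -/
noncomputable def traceProj (S : Finset 𝕄) : 𝕄 →ₗ[ℂ] 𝕄 :=
  ∑ v ∈ S, ((Matrix.traceLinearMap (Fin n) ℂ ℂ ∘ₗ LinearMap.mulLeft ℂ vᴴ).smulRight v)

theorem traceProj_apply (S : Finset 𝕄) (y : 𝕄) :
    traceProj S y = ∑ v ∈ S, (vᴴ * y).trace • v := by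
  simp [traceProj]

variable {M : StarSubalgebra ℂ (Matrix (Fin n) (Fin n) ℂ)} {S : Finset (Matrix (Fin n) (Fin n) ℂ)}

theorem conjTranspose_mem {y : 𝕄} (hy : y ∈ M) : yᴴ ∈ M := star_mem hy

theorem exists_isStarBasis_starSubalgebra (M : StarSubalgebra ℂ 𝕄) :
    ∃ S : Finset 𝕄, IsStarBasis (Subalgebra.toSubmodule M.toSubalgebra) S :=
  exists_isStarBasis _ fun _ hy => conjTranspose_mem hy

theorem eq_of_trace_mul_eq_of_mem {x y : 𝕄} (hx : x ∈ M) (hy : y ∈ M)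
    (h : ∀ z ∈ M, (z * x).trace = (z * y).trace) : x = y := by
  rw [← sub_eq_zero, ← Matrix.trace_conjTranspose_mul_self_eq_zero_iff, mul_sub, Matrix.trace_sub,
    h _ (conjTranspose_mem (sub_mem hx hy)), sub_self]

namespace IsStarBasis

variable (hS : IsStarBasis (Subalgebra.toSubmodule M.toSubalgebra) S)
include hS

theorem mem' {x : 𝕄} (hx : x ∈ S) : x ∈ M := hS.mem x hx

theorem expand' {y : 𝕄} (hy : y ∈ M) : y = ∑ v ∈ S, (vᴴ * y).trace • v := hS.expand y hy

theorem traceProj_eq {y : 𝕄} (hy : y ∈ M) : traceProj S y = y := by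
  rw [traceProj_apply, ← hS.expand y hy]

theorem traceProj_mem (y : 𝕄) : traceProj S y ∈ M := by
  rw [traceProj_apply]
  exact sum_mem fun v hv => M.toSubalgebra.smul_mem (hS.mem' hv) _

theorem expand_conjTranspose {y : 𝕄} (hy : y ∈ M) : y = ∑ v ∈ S, (y * v).trace • vᴴ := by
  have h := congrArg Matrix.conjTranspose (hS.expand yᴴ (conjTranspose_mem hy))
  rw [Matrix.conjTranspose_conjTranspose, Matrix.conjTranspose_sum] at h
  conv_lhs => rw [h]
  refine Finset.sum_congr rfl fun v _ => ?_
  rw [Matrix.conjTranspose_smul, ← Matrix.conjTranspose_mul, Matrix.trace_conjTranspose, star_star]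

theorem trace_mul_traceProj {a : 𝕄} (ha : a ∈ M) (y : 𝕄) :
    (a * traceProj S y).trace = (a * y).trace := by
  conv_rhs => rw [hS.expand_conjTranspose ha]
  rw [traceProj_apply, Matrix.mul_sum, Matrix.sum_mul, Matrix.trace_sum, Matrix.trace_sum]
  refine Finset.sum_congr rfl fun v _ => ?_
  rw [Matrix.mul_smul, Matrix.smul_mul, Matrix.trace_smul, Matrix.trace_smul, smul_eq_mul,
    smul_eq_mul, mul_comm]

theorem traceProj_mul_left {a : 𝕄} (ha : a ∈ M) (y : 𝕄) :
    traceProj S (a * y) = a * traceProj S y :=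
  eq_of_trace_mul_eq_of_mem (hS.traceProj_mem _) (mul_mem ha (hS.traceProj_mem _)) fun z hz => by
    rw [hS.trace_mul_traceProj hz, ← Matrix.mul_assoc, ← Matrix.mul_assoc,
      hS.trace_mul_traceProj (mul_mem hz ha)]

theorem traceProj_conjTranspose (y : 𝕄) : traceProj S yᴴ = (traceProj S y)ᴴ :=
  eq_of_trace_mul_eq_of_mem (hS.traceProj_mem _) (conjTranspose_mem (hS.traceProj_mem _))
    fun z hz => by
      rw [hS.trace_mul_traceProj hz, ← Matrix.conjTranspose_conjTranspose z,
        ← Matrix.conjTranspose_mul, ← Matrix.conjTranspose_mul, Matrix.trace_conjTranspose,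
        Matrix.trace_conjTranspose, Matrix.trace_mul_comm, Matrix.trace_mul_comm _ zᴴ,
        hS.trace_mul_traceProj (conjTranspose_mem hz)]

variable {W : Type*} [AddCommGroup W] [Module ℂ W]

/-- The Casimir element `∑ x ⊗ x*` of a `*`-subalgebra commutes with the subalgebra under the
outer bimodule structure. -/
theorem casimir_left (f : 𝕄 →ₗ[ℂ] 𝕄 →ₗ[ℂ] W) {a : 𝕄} (ha : a ∈ M) :
    ∑ x ∈ S, f (a * x) xᴴ = ∑ x ∈ S, f x (xᴴ * a) := by
  have h1 : ∀ x ∈ S, f (a * x) xᴴ = ∑ y ∈ S, (yᴴ * (a * x)).trace • f y xᴴ := by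
    intro x hx
    conv_lhs => rw [hS.expand' (mul_mem ha (hS.mem' hx))]
    simp
  have h2 : ∀ x ∈ S, f x (xᴴ * a) = ∑ y ∈ S, (xᴴ * (a * y)).trace • f x yᴴ := by
    intro x hx
    conv_lhs => rw [hS.expand_conjTranspose (mul_mem (conjTranspose_mem (hS.mem' hx)) ha)]
    simp [Matrix.mul_assoc]
  rw [Finset.sum_congr rfl h1, Finset.sum_congr rfl h2, Finset.sum_comm]

/-- The Casimir element `∑ x ⊗ x*` of a `*`-subalgebra commutes with the subalgebra under the
inner bimodule structure. -/
theorem casimir_right (f : 𝕄 →ₗ[ℂ] 𝕄 →ₗ[ℂ] W) {a : 𝕄} (ha : a ∈ M) :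
    ∑ x ∈ S, f (x * a) xᴴ = ∑ x ∈ S, f x (a * xᴴ) := by
  have h1 : ∀ x ∈ S, f (x * a) xᴴ = ∑ y ∈ S, (yᴴ * (x * a)).trace • f y xᴴ := by
    intro x hx
    conv_lhs => rw [hS.expand' (mul_mem (hS.mem' hx) ha)]
    simp
  have h2 : ∀ x ∈ S, f x (a * xᴴ) = ∑ y ∈ S, (xᴴ * (y * a)).trace • f x yᴴ := by
    intro x hx
    conv_lhs => rw [hS.expand_conjTranspose (mul_mem ha (conjTranspose_mem (hS.mem' hx)))]
    rw [map_sum]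
    refine Finset.sum_congr rfl fun y _ => ?_
    rw [map_smul, Matrix.mul_assoc, Matrix.trace_mul_comm, Matrix.mul_assoc]
  rw [Finset.sum_congr rfl h1, Finset.sum_congr rfl h2, Finset.sum_comm]

theorem casimir_mem : ∑ x ∈ S, x * xᴴ ∈ M :=
  sum_mem fun _ hx => mul_mem (hS.mem' hx) (conjTranspose_mem (hS.mem' hx))

/-- The averaging map `b ↦ ∑ x b x*` takes values in the commutant of the subalgebra. -/
theorem casimir_conj_comm (b : 𝕄) {a : 𝕄} (ha : a ∈ M) :
    a * ∑ x ∈ S, x * b * xᴴ = (∑ x ∈ S, x * b * xᴴ) * a := by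
  have := hS.casimir_left ((LinearMap.mul ℂ 𝕄) ∘ₗ LinearMap.mulRight ℂ b) ha
  simpa [Matrix.mul_sum, Matrix.sum_mul, Matrix.mul_assoc] using this

/-- The Casimir operator `∑ x x*` is invertible in the centre of the subalgebra. -/
theorem exists_casimir_inv : ∃ R ∈ M, (∑ x ∈ S, x * xᴴ) * R = 1 ∧ R * (∑ x ∈ S, x * xᴴ) = 1 ∧
    Rᴴ = R ∧ ∀ a ∈ M, a * R = R * a := by
  set C := ∑ x ∈ S, x * xᴴ with hC
  have hCcomm : ∀ a ∈ M, a * C = C * a := fun a ha => by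
    simpa using hS.casimir_conj_comm 1 ha
  have hCs : Cᴴ = C := by
    rw [hC, Matrix.conjTranspose_sum]
    simp
  have hinj : ∀ y ∈ M, C * y = 0 → y = 0 := by
    intro y hy h
    have h1 : ∑ x ∈ S, ((xᴴ * y)ᴴ * (xᴴ * y)).trace = 0 := by
      rw [← Matrix.trace_sum]
      have : ∑ x ∈ S, (xᴴ * y)ᴴ * (xᴴ * y) = yᴴ * (C * y) := by
        rw [hC, Matrix.sum_mul, Matrix.mul_sum]
        simp [Matrix.mul_assoc]
      rw [this, h, Matrix.mul_zero, Matrix.trace_zero]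
    have h2 := (Finset.sum_eq_zero_iff_of_nonneg
      fun x _ => trace_conjTranspose_mul_self_nonneg (xᴴ * y)).1 h1
    have h3 := congrArg (· * y) (hS.expand_conjTranspose (one_mem M))
    simp only [Matrix.one_mul, Matrix.sum_mul] at h3
    rw [h3]
    refine Finset.sum_eq_zero fun x hx => ?_
    rw [Matrix.smul_mul, Matrix.trace_conjTranspose_mul_self_eq_zero_iff.1 (h2 x hx), smul_zero]
  let A : Subalgebra.toSubmodule M.toSubalgebra →ₗ[ℂ] Subalgebra.toSubmodule M.toSubalgebra :=
    (LinearMap.mulLeft ℂ C).restrict fun y hy => M.mul_mem hS.casimir_mem hy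
  have hA : Function.Injective A := by
    rw [injective_iff_map_eq_zero]
    intro y hy
    exact Subtype.ext (hinj y y.2 (congrArg Subtype.val hy))
  obtain ⟨⟨R, hR⟩, hR1⟩ := LinearMap.injective_iff_surjective.1 hA ⟨1, one_mem M⟩
  replace hR : R ∈ M := hR
  have hCR : C * R = 1 := congrArg Subtype.val hR1
  have hRC : R * C = 1 := mul_eq_one_comm.1 hCR
  refine ⟨R, hR, hCR, hRC, ?_, fun a ha => ?_⟩
  · have h := congrArg Matrix.conjTranspose hRC
    rw [Matrix.conjTranspose_mul, hCs, Matrix.conjTranspose_one] at h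
    calc Rᴴ = R * C * Rᴴ := by rw [hRC, Matrix.one_mul]
      _ = R := by rw [Matrix.mul_assoc, h, Matrix.mul_one]
  · calc a * R = R * C * a * R := by rw [hRC, Matrix.one_mul]
      _ = R * (C * a) * R := by simp only [Matrix.mul_assoc]
      _ = R * a * (C * R) := by rw [← hCcomm a ha]; simp only [Matrix.mul_assoc]
      _ = R * a := by rw [hCR, Matrix.mul_one]

/-- The matrix units form a frame for the `M`-valued inner product `E (x* y)`, where `E` is the
trace preserving conditional expectation; this exhibits `E (x* y)` as a Gram matrix over `M`. -/
theorem traceProj_frame {R : 𝕄} (hRC : R * (∑ x ∈ S, x * xᴴ) = 1) (hRs : Rᴴ = R)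
    (hRcomm : ∀ a ∈ M, a * R = R * a) (x y : 𝕄) :
    traceProj S (xᴴ * y) = ∑ p : Fin n, ∑ q : Fin n, ∑ z ∈ S,
      (zᴴ * R * traceProj S (Matrix.single p q 1 * x))ᴴ *
        (zᴴ * R * traceProj S (Matrix.single p q 1 * y)) := by
  set C := ∑ x ∈ S, x * xᴴ with hC
  have h1 : ∀ p q : Fin n, ∑ z ∈ S, (zᴴ * R * traceProj S (Matrix.single p q 1 * x))ᴴ *
        (zᴴ * R * traceProj S (Matrix.single p q 1 * y)) =
      traceProj S (xᴴ * Matrix.single q p 1) * R * traceProj S (Matrix.single p q 1 * y) := by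
    intro p q
    have : ∑ z ∈ S, (zᴴ * R * traceProj S (Matrix.single p q 1 * x))ᴴ *
        (zᴴ * R * traceProj S (Matrix.single p q 1 * y)) =
        (traceProj S (Matrix.single p q 1 * x))ᴴ * (R * C) * R *
          traceProj S (Matrix.single p q 1 * y) := by
      rw [hC, Matrix.mul_sum, Matrix.mul_sum, Matrix.sum_mul, Matrix.sum_mul]
      simp [Matrix.mul_assoc, hRs]
    rw [this, hRC, Matrix.mul_one, ← hS.traceProj_conjTranspose, Matrix.conjTranspose_mul,
      Matrix.conjTranspose_single, star_one]
  have h2 : ∑ p : Fin n, ∑ q : Fin n,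
      traceProj S (xᴴ * Matrix.single q p 1) * R * traceProj S (Matrix.single p q 1 * y) =
      ∑ u ∈ S, ∑ v ∈ S, (vᴴ * (uᴴ * (xᴴ * y))).trace • (R * (u * v)) := by
    have h3 : ∀ u v : 𝕄, (vᴴ * (uᴴ * (xᴴ * y))).trace =
        ∑ p : Fin n, ∑ q : Fin n, (uᴴ * (xᴴ * Matrix.single q p 1)).trace *
          (vᴴ * (Matrix.single p q 1 * y)).trace := by
      intro u v
      have e1 : ∀ p q : Fin n, (uᴴ * (xᴴ * Matrix.single q p (1 : ℂ))).trace = (uᴴ * xᴴ) p q := by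
        intro p q
        rw [← Matrix.mul_assoc, Matrix.trace_mul_single]; simp
      have e2 : ∀ p q : Fin n, (vᴴ * (Matrix.single p q (1 : ℂ) * y)).trace = (y * vᴴ) q p := by
        intro p q
        rw [Matrix.trace_mul_comm, Matrix.mul_assoc, Matrix.trace_single_mul]; simp
      simp only [e1, e2]
      rw [Matrix.trace_mul_comm, ← Matrix.mul_assoc, Matrix.mul_assoc (uᴴ * xᴴ)]
      simp [Matrix.trace, Matrix.mul_apply (M := uᴴ * xᴴ)]
    have h5 : ∀ F : Fin n → Fin n → 𝕄 → 𝕄,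
        ∑ p, ∑ q, ∑ u ∈ S, F p q u = ∑ u ∈ S, ∑ p, ∑ q, F p q u := fun F => by
      rw [Finset.sum_comm (s := S)]
      exact Finset.sum_congr rfl fun p _ => Finset.sum_comm
    have h6 : ∀ p q : Fin n,
        traceProj S (xᴴ * Matrix.single q p 1) * R * traceProj S (Matrix.single p q 1 * y) =
        ∑ u ∈ S, ∑ v ∈ S, ((uᴴ * (xᴴ * Matrix.single q p 1)).trace *
          (vᴴ * (Matrix.single p q 1 * y)).trace) • (R * (u * v)) := by
      intro p q
      rw [traceProj_apply, traceProj_apply, Matrix.sum_mul, Matrix.sum_mul]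
      refine Finset.sum_congr rfl fun u hu => ?_
      rw [Matrix.mul_sum]
      refine Finset.sum_congr rfl fun v hv => ?_
      rw [Matrix.smul_mul, Matrix.smul_mul, Matrix.mul_smul, smul_smul, hRcomm u (hS.mem' hu),
        Matrix.mul_assoc]
    simp only [h3, Finset.sum_smul, h6]
    rw [h5]
    exact Finset.sum_congr rfl fun u _ => h5 _
  have h4 : ∀ u ∈ S, ∑ v ∈ S, (vᴴ * (uᴴ * (xᴴ * y))).trace • (R * (u * v)) =
      R * traceProj S (u * uᴴ * (xᴴ * y)) := by
    intro u hu
    have := hS.casimir_left (LinearMap.mk₂ ℂ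
      (fun s t : 𝕄 => (t * (uᴴ * (xᴴ * y))).trace • (R * s))
      (by intros; simp only [Matrix.mul_add, smul_add])
      (by intros; simp only [Matrix.mul_smul]; exact smul_comm _ _ _)
      (by intros; simp only [Matrix.add_mul, Matrix.trace_add, add_smul])
      (by intros; simp only [Matrix.smul_mul, Matrix.trace_smul, smul_assoc])) (hS.mem' hu)
    simp only [LinearMap.mk₂_apply] at this
    rw [this, traceProj_apply, Matrix.mul_sum]
    simp [Matrix.mul_assoc]
  simp only [h1]
  rw [h2, Finset.sum_congr rfl h4, ← Matrix.mul_sum, ← map_sum, ← Matrix.sum_mul, ← hC,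
    hS.traceProj_mul_left hS.casimir_mem, ← Matrix.mul_assoc, hRC, Matrix.one_mul]

end IsStarBasis

end Casimir

/-! ### Splitting off the completely positive part of a generator -/

section Dissipation

/-- The sesquilinear form `∑ ⟨ξ i, F (a i* a j) ξ j⟩`. It is nonnegative for all `a` and `ξ` exactly
when `F` is completely positive. -/
noncomputable def gramForm (F : 𝕄 →ₗ[ℂ] 𝕄) {ι : Type} [Fintype ι] (ξ : ι → Fin n → ℂ)
    (a : ι → 𝕄) : ℂ :=
  ∑ i, ∑ j, star (ξ i) ⬝ᵥ (F ((a i)ᴴ * a j) *ᵥ ξ j)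

theorem star_mulVec_dotProduct (A : 𝕄) (v w : Fin n → ℂ) :
    star (A *ᵥ v) ⬝ᵥ w = star v ⬝ᵥ (Aᴴ *ᵥ w) := by
  rw [Matrix.star_mulVec, Matrix.dotProduct_mulVec]

/-- An operator that is symmetric for the functional `tr (· σ)` commutes with the modular
operator. -/
theorem map_modular_of_symmetric {σ : 𝕄} (hσ : σ.PosDef) {G : 𝕄 →ₗ[ℂ] 𝕄}
    (hG : ∀ x y, (G x * y * σ).trace = (x * G y * σ).trace) (x : 𝕄) :
    G (σ * x * σ⁻¹) = σ * G x * σ⁻¹ := by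
  have hu := isUnit_det_of_posDef hσ
  have h : ∀ x y : 𝕄, (x * y * σ).trace = (y * (σ * x * σ⁻¹) * σ).trace := by
    intro x y
    rw [Matrix.mul_assoc y, Matrix.nonsing_inv_mul_cancel_right _ _ hu, Matrix.trace_mul_comm,
      ← Matrix.mul_assoc, Matrix.trace_mul_comm]
  have h1 : G (σ * x * σ⁻¹) * σ = σ * G x * σ⁻¹ * σ := by
    refine eq_of_trace_mul_eq fun z => ?_
    rw [← Matrix.mul_assoc, ← Matrix.mul_assoc, ← hG, ← h, ← hG, ← h]
  have h2 := congrArg (· * σ⁻¹) h1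
  simpa only [Matrix.mul_nonsing_inv_cancel_right _ _ hu] using h2

/-- The properties of the generator of a semigroup on `M` with `σ`-detailed balance, for a map `G`
on all matrices that takes values in `M`. Complete positivity of the semigroup appears as conditional
complete positivity: the form `gramForm G` is nonnegative on families with entries in `M` and
`∑ a i ξ i = 0`. Symmetry for `tr (· σ)` is required in its bilinear form and on all matrices. -/
structure IsDetailedBalanceGenerator (M : StarSubalgebra ℂ 𝕄) (σ : 𝕄) (G : 𝕄 →ₗ[ℂ] 𝕄) : Prop where
  map_mem : ∀ x, G x ∈ M
  map_one : G 1 = 0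
  map_conjTranspose : ∀ x, G xᴴ = (G x)ᴴ
  symmetric : ∀ x y, (G x * y * σ).trace = (x * G y * σ).trace
  gramForm_nonneg : ∀ {ι : Type} [Fintype ι] (ξ : ι → Fin n → ℂ) (a : ι → 𝕄),
    (∀ i, a i ∈ M) → ∑ i, a i *ᵥ ξ i = 0 → 0 ≤ gramForm G ξ a

/-- The drift coefficient `K = ∑ G(x) x* R` of a generator, for `x` running through a star basis
and `R` the inverse Casimir operator. It replaces the average of `G(u) u*` over the unitary group
of `M`: like that average it satisfies `∑ G(a x) x* R = K a`. -/
noncomputable def drift (S : Finset 𝕄) (R : 𝕄) (G : 𝕄 →ₗ[ℂ] 𝕄) : 𝕄 := ∑ x ∈ S, G x * xᴴ * R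

/-- The bilinear map `(u, v) ↦ F u * B * v`. -/
noncomputable def mulBilin (F : 𝕄 →ₗ[ℂ] 𝕄) (B : 𝕄) : 𝕄 →ₗ[ℂ] 𝕄 →ₗ[ℂ] 𝕄 :=
  LinearMap.mul ℂ 𝕄 ∘ₗ LinearMap.mulRight ℂ B ∘ₗ F

theorem mulBilin_apply (F : 𝕄 →ₗ[ℂ] 𝕄) (B u v : 𝕄) : mulBilin F B u v = F u * B * v := by
  simp [mulBilin]

namespace IsStarBasis

variable {M : StarSubalgebra ℂ (Matrix (Fin n) (Fin n) ℂ)} {S : Finset (Matrix (Fin n) (Fin n) ℂ)}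
  {σ R : Matrix (Fin n) (Fin n) ℂ} {G : Matrix (Fin n) (Fin n) ℂ →ₗ[ℂ] Matrix (Fin n) (Fin n) ℂ}

variable (hS : IsStarBasis (Subalgebra.toSubmodule M.toSubalgebra) S)
include hS

theorem drift_mem (hR : R ∈ M) (hG : ∀ x, G x ∈ M) : drift S R G ∈ M :=
  sum_mem fun _ hx => mul_mem (mul_mem (hG _) (conjTranspose_mem (hS.mem' hx))) hR

theorem sum_map_mul_eq_drift_mul (hRcomm : ∀ a ∈ M, a * R = R * a) {a : 𝕄} (ha : a ∈ M) :
    ∑ x ∈ S, G (a * x) * xᴴ * R = drift S R G * a := by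
  have h := hS.casimir_left (mulBilin G 1) ha
  simp only [mulBilin_apply, Matrix.mul_one] at h
  rw [drift, ← Matrix.sum_mul, h, Matrix.sum_mul, Matrix.sum_mul]
  exact Finset.sum_congr rfl fun x _ => by
    simp only [Matrix.mul_assoc, hRcomm a ha]

/-- Since the generator commutes with the modular operator, its drift commutes with the density
matrix. -/
theorem drift_comm (hσ : σ.PosDef) (hσM : σ ∈ M) (hRcomm : ∀ a ∈ M, a * R = R * a)
    (hG : ∀ x y, (G x * y * σ).trace = (x * G y * σ).trace) :
    σ * drift S R G = drift S R G * σ := by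
  have hu := isUnit_det_of_posDef hσ
  have h1 := hS.casimir_left (mulBilin (G ∘ₗ LinearMap.mulRight ℂ σ⁻¹) σ) hσM
  have h2 := hS.casimir_right (mulBilin (G ∘ₗ LinearMap.mulRight ℂ σ⁻¹) 1) hσM
  simp only [mulBilin_apply, LinearMap.comp_apply, LinearMap.mulRight_apply, Matrix.mul_one,
    Matrix.mul_nonsing_inv_cancel_right _ _ hu] at h1 h2
  calc σ * drift S R G = (∑ x ∈ S, G (σ * x * σ⁻¹) * σ * xᴴ) * R := by
        rw [drift, Matrix.mul_sum, Matrix.sum_mul]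
        refine Finset.sum_congr rfl fun x _ => ?_
        rw [map_modular_of_symmetric hσ hG, Matrix.nonsing_inv_mul_cancel_right _ _ hu]
        simp only [Matrix.mul_assoc]
    _ = (∑ x ∈ S, G x * xᴴ) * σ * R := by
        rw [h1, h2, Matrix.sum_mul]
        simp only [Matrix.mul_assoc, Matrix.sum_mul]
    _ = drift S R G * σ := by
        rw [Matrix.mul_assoc, hRcomm σ hσM, ← Matrix.mul_assoc, drift, Matrix.sum_mul]

/-- Detailed balance makes the drift self-adjoint. -/
theorem drift_conjTranspose (hσ : σ.PosDef) (hσM : σ ∈ M) (hR : R ∈ M) (hRs : Rᴴ = R)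
    (hRcomm : ∀ a ∈ M, a * R = R * a) (hG : IsDetailedBalanceGenerator M σ G) :
    (drift S R G)ᴴ = drift S R G := by
  have hu := isUnit_det_of_posDef hσ
  have hK : drift S R G ∈ M := hS.drift_mem hR hG.map_mem
  have hKs : (drift S R G)ᴴ = ∑ x ∈ S, R * (x * G xᴴ) := by
    rw [drift, Matrix.conjTranspose_sum]
    refine Finset.sum_congr rfl fun x _ => ?_
    rw [Matrix.conjTranspose_mul, Matrix.conjTranspose_mul, hRs, Matrix.conjTranspose_conjTranspose,
      hG.map_conjTranspose]
  -- symmetry of `G` and the Casimir identity give `tr (K z σ) = tr (z K* σ)` for `z ∈ M`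
  have h1 : σ * drift S R G = (drift S R G)ᴴ * σ := by
    refine eq_of_trace_mul_eq_of_mem (mul_mem hσM hK) (mul_mem (conjTranspose_mem hK) hσM)
      fun z hz => ?_
    have h2 := hS.casimir_left (LinearMap.mk₂ ℂ (fun u v : 𝕄 => (u * G v * σ).trace)
      (by intros; simp only [Matrix.add_mul, Matrix.trace_add])
      (by intros; simp only [Matrix.smul_mul, Matrix.trace_smul])
      (by intros; simp only [map_add, Matrix.mul_add, Matrix.add_mul, Matrix.trace_add])
      (by intros; simp only [map_smul, Matrix.mul_smul, Matrix.smul_mul, Matrix.trace_smul]))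
      (mul_mem hR hz)
    simp only [LinearMap.mk₂_apply] at h2
    calc (z * (σ * drift S R G)).trace = ∑ x ∈ S, (G x * (xᴴ * (R * z)) * σ).trace := by
          rw [← Matrix.mul_assoc, Matrix.trace_mul_comm, drift, Matrix.sum_mul, Matrix.trace_sum]
          simp only [Matrix.mul_assoc]
      _ = ∑ x ∈ S, (x * G (xᴴ * (R * z)) * σ).trace :=
          Finset.sum_congr rfl fun x _ => hG.symmetric _ _
      _ = (z * ((drift S R G)ᴴ * σ)).trace := by
          rw [← h2, hKs, Matrix.sum_mul, Matrix.mul_sum, Matrix.trace_sum, ← hRcomm z hz]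
          simp only [Matrix.mul_assoc]
  have h3 := congrArg (· * σ⁻¹) (h1.symm.trans (hS.drift_comm hσ hσM hRcomm hG.symmetric))
  simpa only [Matrix.mul_nonsing_inv_cancel_right _ _ hu] using h3

/-- Subtracting the drift terms from a conditionally completely positive map leaves a completely
positive one. This follows by testing conditional positivity on the given vectors together with
the vectors `-x* R ∑ a j ξ j` paired with the basis elements `x`. -/
theorem gramForm_sub_drift_nonneg (hRC : (∑ x ∈ S, x * xᴴ) * R = 1) (hRs : Rᴴ = R)
    (hRcomm : ∀ a ∈ M, a * R = R * a) (hG : IsDetailedBalanceGenerator M σ G)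
    {K Z : 𝕄} (hK : K = drift S R G) (hZ : Z = R * ∑ x ∈ S, x * K * xᴴ)
    {ι : Type} [Fintype ι] (ξ : ι → Fin n → ℂ) (a : ι → 𝕄) (ha : ∀ i, a i ∈ M) :
    0 ≤ ∑ i, ∑ j, star (ξ i) ⬝ᵥ ((G ((a i)ᴴ * a j) - K * ((a i)ᴴ * a j) - (a i)ᴴ * a j * Kᴴ +
      Z * ((a i)ᴴ * a j)) *ᵥ ξ j) := by
  have hZcomm : ∀ b ∈ M, b * Z = Z * b := fun b hb => by
    rw [hZ, ← Matrix.mul_assoc, hRcomm b hb, Matrix.mul_assoc, hS.casimir_conj_comm K hb,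
      Matrix.mul_assoc]
  set c := ∑ j, a j *ᵥ ξ j with hc
  have hdrift : ∀ b ∈ M, ∑ x : S, G (b * x) * (x : 𝕄)ᴴ * R = K * b := fun b hb => by
    rw [hK, ← hS.sum_map_mul_eq_drift_mul hRcomm hb]
    exact Finset.sum_coe_sort S fun x => G (b * x) * xᴴ * R
  have hdrift' : ∀ b ∈ M, ∑ x : S, R * (x * G ((x : 𝕄)ᴴ * b)) = b * Kᴴ := fun b hb => by
    have h := congrArg Matrix.conjTranspose (hdrift bᴴ (conjTranspose_mem hb))
    rw [Matrix.conjTranspose_sum, Matrix.conjTranspose_mul, Matrix.conjTranspose_conjTranspose] at h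
    rw [← h]
    refine Finset.sum_congr rfl fun x _ => ?_
    rw [Matrix.conjTranspose_mul, Matrix.conjTranspose_mul, hRs, Matrix.conjTranspose_conjTranspose,
      ← hG.map_conjTranspose, Matrix.conjTranspose_mul, Matrix.conjTranspose_conjTranspose]
  -- the vectors paired with the basis elements; they cancel `c` because `∑ x x* R = 1`
  let η : S → Fin n → ℂ := fun x => -(((x : 𝕄)ᴴ * R) *ᵥ c)
  have hpos := hG.gramForm_nonneg (Sum.elim ξ η) (Sum.elim a fun x : S => (x : 𝕄))
    (by
      rintro (i | x)
      exacts [ha i, hS.mem' x.2])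
    (by
      rw [Fintype.sum_sum_type]
      simp only [Sum.elim_inl, Sum.elim_inr, η, Matrix.mulVec_neg, Matrix.mulVec_mulVec,
        Finset.sum_neg_distrib, ← Matrix.mul_assoc]
      rw [← hc, ← Matrix.sum_mulVec, ← Matrix.sum_mul, Finset.sum_coe_sort S fun x => x * xᴴ, hRC,
        Matrix.one_mulVec, add_neg_cancel])
  have hcross : ∀ i, ∑ x : S, star (ξ i) ⬝ᵥ (G ((a i)ᴴ * x) *ᵥ η x) =
      -∑ j, star (ξ i) ⬝ᵥ ((K * ((a i)ᴴ * a j)) *ᵥ ξ j) := by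
    intro i
    have : ∑ x : S, star (ξ i) ⬝ᵥ (G ((a i)ᴴ * x) *ᵥ η x) =
        -(star (ξ i) ⬝ᵥ ((K * (a i)ᴴ) *ᵥ c)) := by
      rw [← hdrift _ (conjTranspose_mem (ha i)), Matrix.sum_mulVec, dotProduct_sum,
        ← Finset.sum_neg_distrib]
      refine Finset.sum_congr rfl fun x _ => ?_
      simp only [η, Matrix.mulVec_neg, Matrix.mulVec_mulVec, dotProduct_neg, Matrix.mul_assoc]
    rw [this, hc, Matrix.mulVec_sum, dotProduct_sum]
    simp only [Matrix.mulVec_mulVec, Matrix.mul_assoc]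
  have hη : ∀ (x : S) (w : Fin n → ℂ), star (η x) ⬝ᵥ w = -(star c ⬝ᵥ ((R * (x : 𝕄)) *ᵥ w)) := by
    intro x w
    simp only [η, star_neg, neg_dotProduct, star_mulVec_dotProduct, Matrix.conjTranspose_mul, hRs,
      Matrix.conjTranspose_conjTranspose]
  have hcross' : ∀ j, ∑ x : S, star (η x) ⬝ᵥ (G ((x : 𝕄)ᴴ * a j) *ᵥ ξ j) =
      -∑ i, star (ξ i) ⬝ᵥ (((a i)ᴴ * a j * Kᴴ) *ᵥ ξ j) := by
    intro j
    have : ∑ x : S, star (η x) ⬝ᵥ (G ((x : 𝕄)ᴴ * a j) *ᵥ ξ j) =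
        -(star c ⬝ᵥ ((a j * Kᴴ) *ᵥ ξ j)) := by
      rw [← hdrift' _ (ha j), Matrix.sum_mulVec, dotProduct_sum, ← Finset.sum_neg_distrib]
      refine Finset.sum_congr rfl fun x _ => ?_
      rw [hη, Matrix.mulVec_mulVec, Matrix.mul_assoc]
    rw [this, hc, star_sum, sum_dotProduct]
    simp only [star_mulVec_dotProduct, Matrix.mulVec_mulVec, Matrix.mul_assoc]
  have hlast : ∑ x : S, ∑ y : S, star (η x) ⬝ᵥ (G ((x : 𝕄)ᴴ * y) *ᵥ η y) =
      ∑ i, ∑ j, star (ξ i) ⬝ᵥ ((Z * ((a i)ᴴ * a j)) *ᵥ ξ j) := by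
    have : ∑ x : S, ∑ y : S, star (η x) ⬝ᵥ (G ((x : 𝕄)ᴴ * y) *ᵥ η y) = star c ⬝ᵥ (Z *ᵥ c) := by
      rw [hZ, ← Finset.sum_coe_sort S fun x => x * K * xᴴ, Matrix.mul_sum, Matrix.sum_mulVec,
        dotProduct_sum]
      refine Finset.sum_congr rfl fun x _ => ?_
      rw [Matrix.mul_assoc (x : 𝕄),
        ← hdrift _ (conjTranspose_mem (hS.mem' x.2)), Matrix.mul_sum, Matrix.mul_sum,
        Matrix.sum_mulVec, dotProduct_sum]
      refine Finset.sum_congr rfl fun y _ => ?_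
      rw [hη]
      simp only [η, Matrix.mulVec_neg, dotProduct_neg, neg_neg, Matrix.mulVec_mulVec,
        Matrix.mul_assoc]
    rw [this, hc, star_sum, sum_dotProduct]
    refine Finset.sum_congr rfl fun i _ => ?_
    rw [Matrix.mulVec_sum, dotProduct_sum]
    refine Finset.sum_congr rfl fun j _ => ?_
    rw [star_mulVec_dotProduct, Matrix.mulVec_mulVec, Matrix.mulVec_mulVec, ← Matrix.mul_assoc,
      hZcomm _ (conjTranspose_mem (ha i)), Matrix.mul_assoc]
  rw [gramForm, Fintype.sum_sum_type] at hpos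
  simp only [Fintype.sum_sum_type, Sum.elim_inl, Sum.elim_inr, Finset.sum_add_distrib, hcross,
    hlast] at hpos
  rw [Finset.sum_comm (f := fun (x : S) (j : ι) => star (η x) ⬝ᵥ (G ((x : 𝕄)ᴴ * a j) *ᵥ ξ j)),
    Finset.sum_congr rfl fun j _ => hcross' j, Finset.sum_neg_distrib, Finset.sum_neg_distrib,
    Finset.sum_comm (f := fun j i => star (ξ i) ⬝ᵥ (((a i)ᴴ * a j * Kᴴ) *ᵥ ξ j))] at hpos
  refine hpos.trans_eq ?_
  simp only [Matrix.add_mulVec, Matrix.sub_mulVec, dotProduct_add, dotProduct_sub,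
    Finset.sum_add_distrib, Finset.sum_sub_distrib]
  ring

end IsStarBasis

/-- A Lindblad form `x ↦ k x + x k + Ψ x` on all matrices satisfying detailed balance: `Ψ` is
completely positive and symmetric for the functional `tr (· σ)`, and `k` is self-adjoint and
commutes with `σ`. -/
structure IsDetailedBalanceForm (σ k : 𝕄) (Ψ : 𝕄 →ₗ[ℂ] 𝕄) : Prop where
  conjTranspose_eq : kᴴ = k
  comm : σ * k = k * σ
  gramForm_nonneg : ∀ {ι : Type} [Fintype ι] (ξ : ι → Fin n → ℂ) (a : ι → 𝕄), 0 ≤ gramForm Ψ ξ a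
  symmetric : ∀ x y, (Ψ x * y * σ).trace = (x * Ψ y * σ).trace
  map_conjTranspose : ∀ x, Ψ xᴴ = (Ψ x)ᴴ

/-- A detailed balance generator on `M` is the restriction of a Lindblad form on all matrices. The
completely positive part on `M` is composed with the conditional expectation onto `M`, which
preserves `tr (· σ)` because `σ ∈ M`. -/
theorem IsDetailedBalanceGenerator.exists_form {M : StarSubalgebra ℂ 𝕄} {σ : 𝕄} {G : 𝕄 →ₗ[ℂ] 𝕄}
    (hG : IsDetailedBalanceGenerator M σ G) (hσ : σ.PosDef) (hσM : σ ∈ M) :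
    ∃ (k : 𝕄) (Ψ : 𝕄 →ₗ[ℂ] 𝕄), IsDetailedBalanceForm σ k Ψ ∧
      ∀ x ∈ M, G x = k * x + x * k + Ψ x := by
  obtain ⟨S, hS⟩ := exists_isStarBasis_starSubalgebra M
  obtain ⟨R, hR, hCR, hRC, hRs, hRcomm⟩ := hS.exists_casimir_inv
  obtain ⟨K, hK⟩ : ∃ K, K = drift S R G := ⟨_, rfl⟩
  obtain ⟨Z, hZ⟩ : ∃ Z, Z = R * ∑ x ∈ S, x * K * xᴴ := ⟨_, rfl⟩
  have hKM : K ∈ M := hK ▸ hS.drift_mem hR hG.map_mem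
  have hKs : Kᴴ = K := by rw [hK, hS.drift_conjTranspose hσ hσM hR hRs hRcomm hG]
  have hKσ : σ * K = K * σ := by rw [hK, hS.drift_comm hσ hσM hRcomm hG.symmetric]
  have hZM : Z ∈ M := hZ ▸ mul_mem hR (sum_mem fun x hx =>
    mul_mem (mul_mem (hS.mem' hx) hKM) (conjTranspose_mem (hS.mem' hx)))
  have hZcomm : ∀ b ∈ M, b * Z = Z * b := fun b hb => by
    rw [hZ, ← Matrix.mul_assoc, hRcomm b hb, Matrix.mul_assoc, hS.casimir_conj_comm K hb,
      Matrix.mul_assoc]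
  have hZs : Zᴴ = Z := by
    have : (∑ x ∈ S, x * K * xᴴ)ᴴ = ∑ x ∈ S, x * K * xᴴ := by
      rw [Matrix.conjTranspose_sum]
      simp [hKs, Matrix.mul_assoc]
    rw [hZ, Matrix.conjTranspose_mul, hRs, this]
    exact hS.casimir_conj_comm K hR |>.symm
  -- the central correction `Z x` is shared equally between left and right multiplication
  set k : 𝕄 := K - (1 / 2 : ℂ) • Z with hk
  have hkM : k ∈ M := sub_mem hKM (M.toSubalgebra.smul_mem hZM _)
  have hks : kᴴ = k := by
    rw [hk, Matrix.conjTranspose_sub, hKs, Matrix.conjTranspose_smul, hZs]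
    simp
  have hkσ : σ * k = k * σ := by
    rw [hk, mul_sub, sub_mul, hKσ, Matrix.mul_smul, Matrix.smul_mul, hZcomm σ hσM]
  let E := traceProj S
  let Ψ : 𝕄 →ₗ[ℂ] 𝕄 := (G - LinearMap.mulLeft ℂ k - LinearMap.mulRight ℂ k) ∘ₗ E
  have hΨ : ∀ x, Ψ x = G (E x) - k * E x - E x * k := fun x => by simp [Ψ]
  have hEM : ∀ x, E x ∈ M := hS.traceProj_mem
  have hE : ∀ a ∈ M, ∀ y, (a * E y).trace = (a * y).trace := fun a ha y =>
    hS.trace_mul_traceProj ha y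
  refine ⟨k, Ψ, ⟨hks, hkσ, ?_, ?_, ?_⟩, ?_⟩
  · intro ι _ ξ a
    have hform : ∀ x ∈ M, Ψ x = G x - K * x - x * Kᴴ + Z * x := by
      intro x hx
      rw [hΨ, show E x = x from hS.traceProj_eq hx, hk, sub_mul, mul_sub, Matrix.mul_smul,
        Matrix.smul_mul, hZcomm x hx, hKs]
      module
    have hΨE : ∀ x, Ψ (E x) = Ψ x := fun x => by
      rw [hΨ, hΨ, show E (E x) = E x from hS.traceProj_eq (hEM x)]
    have hsum : gramForm Ψ ξ a = ∑ p : Fin n, ∑ q : Fin n, ∑ z ∈ S,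
        gramForm Ψ ξ fun i => zᴴ * R * E (Matrix.single p q 1 * a i) := by
      have h1 : ∀ i j, star (ξ i) ⬝ᵥ (Ψ ((a i)ᴴ * a j) *ᵥ ξ j) =
          ∑ t ∈ Finset.univ ×ˢ Finset.univ ×ˢ S, star (ξ i) ⬝ᵥ
            (Ψ ((t.2.2ᴴ * R * E (Matrix.single t.1 t.2.1 1 * a i))ᴴ *
              (t.2.2ᴴ * R * E (Matrix.single t.1 t.2.1 1 * a j))) *ᵥ ξ j) := by
        intro i j
        rw [← hΨE, show E ((a i)ᴴ * a j) = _ from hS.traceProj_frame hRC hRs hRcomm (a i) (a j)]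
        simp only [map_sum, Matrix.sum_mulVec, dotProduct_sum, Finset.sum_product]
        rfl
      have h2 : ∑ p : Fin n, ∑ q : Fin n, ∑ z ∈ S,
          gramForm Ψ ξ (fun i => zᴴ * R * E (Matrix.single p q 1 * a i)) =
          ∑ t ∈ Finset.univ ×ˢ Finset.univ ×ˢ S,
            gramForm Ψ ξ (fun i => t.2.2ᴴ * R * E (Matrix.single t.1 t.2.1 1 * a i)) := by
        simp only [Finset.sum_product]
      rw [h2]
      simp only [gramForm, h1]
      rw [Finset.sum_comm (s := Finset.univ ×ˢ Finset.univ ×ˢ S)]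
      exact Finset.sum_congr rfl fun i _ => Finset.sum_comm
    rw [hsum]
    refine Finset.sum_nonneg fun p _ => Finset.sum_nonneg fun q _ =>
      Finset.sum_nonneg fun z hz => ?_
    have hmem : ∀ i, zᴴ * R * E (Matrix.single p q 1 * a i) ∈ M := fun i =>
      mul_mem (mul_mem (conjTranspose_mem (hS.mem' hz)) hR) (hEM _)
    refine (hS.gramForm_sub_drift_nonneg hCR hRs hRcomm hG hK hZ ξ _ hmem).trans_eq ?_
    refine Finset.sum_congr rfl fun i _ => Finset.sum_congr rfl fun j _ => ?_
    rw [hform _ (mul_mem (conjTranspose_mem (hmem i)) (hmem j))]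
  · intro x y
    have h1 : (G (E x) * y * σ).trace = (x * G (E y) * σ).trace := by
      have := hG.symmetric (E x) (E y)
      rw [Matrix.trace_mul_comm, ← Matrix.mul_assoc, hE _ (mul_mem hσM (hG.map_mem _)),
        Matrix.mul_assoc, Matrix.trace_mul_comm, Matrix.mul_assoc (E x),
        Matrix.trace_mul_comm (E x), hE _ (mul_mem (hG.map_mem _) hσM),
        Matrix.trace_mul_comm, ← Matrix.mul_assoc] at this
      rw [Matrix.trace_mul_comm, ← Matrix.mul_assoc, this, Matrix.trace_mul_comm,
        ← Matrix.mul_assoc]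
    have h2 : ∀ b ∈ M, (b * y * σ).trace = (b * E y * σ).trace := fun b hb => by
      rw [Matrix.trace_mul_comm, ← Matrix.mul_assoc, ← hE _ (mul_mem hσM hb), Matrix.mul_assoc,
        Matrix.trace_mul_comm]
    have h3 : ∀ b ∈ M, (x * b * σ).trace = (E x * b * σ).trace := fun b hb => by
      rw [Matrix.mul_assoc, Matrix.trace_mul_comm, ← hE _ (mul_mem hb hσM), Matrix.trace_mul_comm,
        Matrix.mul_assoc]
    simp only [hΨ, sub_mul, mul_sub, Matrix.trace_sub]
    rw [h1, h2 _ (mul_mem hkM (hEM x)), h2 _ (mul_mem (hEM x) hkM), h3 _ (mul_mem hkM (hEM y)),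
      h3 _ (mul_mem (hEM y) hkM)]
    have h4 : (k * E x * E y * σ).trace = (E x * (E y * k) * σ).trace := by
      rw [Matrix.mul_assoc, Matrix.mul_assoc, Matrix.trace_mul_comm]
      simp only [Matrix.mul_assoc, hkσ]
    rw [h4, Matrix.mul_assoc (E x) k]
    ring
  · intro x
    rw [hΨ, hΨ, show E xᴴ = (E x)ᴴ from hS.traceProj_conjTranspose x, hG.map_conjTranspose,
      Matrix.conjTranspose_sub, Matrix.conjTranspose_sub, Matrix.conjTranspose_mul,
      Matrix.conjTranspose_mul, hks]
    abel
  · intro x hx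
    rw [hΨ, show E x = x from hS.traceProj_eq hx]
    abel

end Dissipation

/-! ### The reshuffling of a map on matrices -/

section Reshuffle

/-- The reshuffling of a map on matrices: the linear involution that turns `x ↦ A x B` into
`y ↦ tr (A y) B`. It turns a completely positive map into a positive operator on the Hilbert space
of matrices (the Choi matrix, up to conjugation). -/
noncomputable def reshuffle : (𝕄 →ₗ[ℂ] 𝕄) →ₗ[ℂ] (𝕄 →ₗ[ℂ] 𝕄) where
  toFun F := ∑ p : Fin n, ∑ q : Fin n,
    LinearMap.mulRight ℂ (F (Matrix.single p q 1)) ∘ₗ LinearMap.mulLeft ℂ (Matrix.single q p 1)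
  map_add' F F' := by
    ext1 y
    simp [mul_add, Finset.sum_add_distrib]
  map_smul' c F := by
    ext1 y
    simp [Finset.smul_sum]

theorem reshuffle_apply (F : 𝕄 →ₗ[ℂ] 𝕄) (y : 𝕄) : reshuffle F y =
    ∑ p : Fin n, ∑ q : Fin n, Matrix.single q p 1 * y * F (Matrix.single p q 1) := by
  simp [reshuffle]

theorem reshuffle_apply_apply (F : 𝕄 →ₗ[ℂ] 𝕄) (y : 𝕄) (i j : Fin n) :
    reshuffle F y i j = ∑ p, ∑ b, y p b * F (Matrix.single p i 1) b j := by
  rw [reshuffle_apply, Matrix.sum_apply]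
  refine Finset.sum_congr rfl fun p _ => ?_
  rw [Matrix.sum_apply, Finset.sum_eq_single i]
  · rw [Matrix.mul_assoc, Matrix.single_mul_apply_same, one_mul, Matrix.mul_apply]
  · intro q _ hq
    rw [Matrix.mul_assoc, Matrix.single_mul_apply_of_ne _ _ _ _ _ hq.symm]
  · simp

theorem reshuffle_single (F : 𝕄 →ₗ[ℂ] 𝕄) (p a i j : Fin n) :
    reshuffle F (Matrix.single p a 1) i j = F (Matrix.single p i 1) a j := by
  rw [reshuffle_apply_apply, Finset.sum_eq_single p, Finset.sum_eq_single a]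
  · simp
  · intro b _ hb; simp [hb.symm]
  · simp
  · intro q _ hq; simp [hq.symm]
  · simp

theorem map_eq_sum_single (F : 𝕄 →ₗ[ℂ] 𝕄) (x : 𝕄) :
    F x = ∑ p : Fin n, ∑ q : Fin n, x p q • F (Matrix.single p q 1) := by
  conv_lhs => rw [Matrix.matrix_eq_sum_single x]
  simp only [map_sum]
  refine Finset.sum_congr rfl fun p _ => Finset.sum_congr rfl fun a _ => ?_
  rw [← map_smul, Matrix.smul_single, smul_eq_mul, mul_one]

theorem linearMap_ext_single {F F' : 𝕄 →ₗ[ℂ] 𝕄}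
    (h : ∀ p a : Fin n, F (Matrix.single p a 1) = F' (Matrix.single p a 1)) : F = F' := by
  refine LinearMap.ext fun x => ?_
  simp only [map_eq_sum_single F x, map_eq_sum_single F' x, h]

theorem reshuffle_reshuffle (F : 𝕄 →ₗ[ℂ] 𝕄) : reshuffle (reshuffle F) = F :=
  linearMap_ext_single fun p a => by
    ext i j
    rw [reshuffle_single, reshuffle_single]

/-- The rank one operator `y ↦ tr (A y) B`. -/
noncomputable def traceRankOne (A B : 𝕄) : 𝕄 →ₗ[ℂ] 𝕄 :=
  (Matrix.traceLinearMap (Fin n) ℂ ℂ ∘ₗ LinearMap.mulLeft ℂ A).smulRight B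

theorem traceRankOne_apply (A B y : 𝕄) : traceRankOne A B y = (A * y).trace • B := by
  simp [traceRankOne]

theorem reshuffle_traceRankOne (A B x : 𝕄) : reshuffle (traceRankOne A B) x = A * x * B := by
  have : reshuffle (traceRankOne A B) = LinearMap.mulRight ℂ B ∘ₗ LinearMap.mulLeft ℂ A := by
    refine linearMap_ext_single fun p a => ?_
    ext i j
    rw [reshuffle_single, traceRankOne_apply, Matrix.trace_mul_single]
    simp [Matrix.mul_apply, Matrix.single_apply, ite_and]
  rw [this]; simp

/-- In the definition of the reshuffling, matrix units may be replaced by any star basis. -/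
theorem reshuffle_eq_sum {S : Finset 𝕄}
    (hS : IsStarBasis (Subalgebra.toSubmodule (⊤ : StarSubalgebra ℂ 𝕄).toSubalgebra) S)
    (F : 𝕄 →ₗ[ℂ] 𝕄) (y : 𝕄) : reshuffle F y = ∑ x ∈ S, xᴴ * y * F x := by
  have h : ∀ x : 𝕄, xᴴ * y * F x =
      ∑ p : Fin n, ∑ q : Fin n, x p q • (xᴴ * y * F (Matrix.single p q 1)) := by
    intro x
    rw [map_eq_sum_single F x]
    simp only [Matrix.mul_sum, Matrix.mul_smul]
  simp only [h]
  rw [reshuffle_apply]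
  symm
  rw [Finset.sum_comm]
  refine Finset.sum_congr rfl fun p _ => ?_
  rw [Finset.sum_comm]
  refine Finset.sum_congr rfl fun q _ => ?_
  conv_rhs => rw [hS.expand_conjTranspose (y := Matrix.single q p 1) StarSubalgebra.mem_top]
  rw [Matrix.sum_mul, Matrix.sum_mul]
  refine Finset.sum_congr rfl fun x _ => ?_
  rw [Matrix.trace_single_mul, one_smul, Matrix.smul_mul, Matrix.smul_mul]

theorem trace_conjTranspose_mul_eq_sum (x y : 𝕄) :
    (xᴴ * y).trace = ∑ i, ∑ j, star (x i j) * y i j := by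
  simp only [Matrix.trace, Matrix.diag_apply, Matrix.mul_apply, Matrix.conjTranspose_apply]
  exact Finset.sum_comm

/-- The reshuffling of a Hermitian map is symmetric for the trace form. -/
theorem reshuffle_symmetric {F : 𝕄 →ₗ[ℂ] 𝕄} (hF : ∀ x, F xᴴ = (F x)ᴴ) (x y : 𝕄) :
    ((reshuffle F x)ᴴ * y).trace = (xᴴ * reshuffle F y).trace := by
  have h : ∀ p i b j, star (F (Matrix.single i p 1) j b) = F (Matrix.single p i 1) b j := by
    intro p i b j
    rw [← Matrix.conjTranspose_apply, ← hF, Matrix.conjTranspose_single, star_one]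
  rw [trace_conjTranspose_mul_eq_sum, trace_conjTranspose_mul_eq_sum]
  simp only [reshuffle_apply_apply, star_sum, star_mul', h, Finset.sum_mul, Finset.mul_sum]
  have hswap : ∀ f : Fin n → Fin n → Fin n → Fin n → ℂ,
      ∑ i, ∑ j, ∑ p, ∑ b, f i j p b = ∑ i, ∑ j, ∑ p, ∑ b, f p b i j := fun f => by
    have : ∑ x : Fin n × Fin n, ∑ y : Fin n × Fin n, f x.1 x.2 y.1 y.2 =
      ∑ x : Fin n × Fin n, ∑ y : Fin n × Fin n, f y.1 y.2 x.1 x.2 := Finset.sum_comm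
    simpa only [Fintype.sum_prod_type] using this
  rw [hswap]
  refine Finset.sum_congr rfl fun i _ => Finset.sum_congr rfl fun j _ =>
    Finset.sum_congr rfl fun p _ => Finset.sum_congr rfl fun b _ => ?_
  ring

/-- The reshuffling of a completely positive map is a positive operator. -/
theorem reshuffle_nonneg {F : 𝕄 →ₗ[ℂ] 𝕄}
    (hF : ∀ (ξ : Fin n → Fin n → ℂ) (a : Fin n → 𝕄), 0 ≤ gramForm F ξ a) (y : 𝕄) :
    0 ≤ (yᴴ * reshuffle F y).trace := by
  rcases isEmpty_or_nonempty (Fin n) with hn | ⟨⟨i₀⟩⟩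
  · simp [Matrix.trace]
  have h := hF (fun p b => star (y p b)) (fun p => Matrix.single i₀ p 1)
  refine h.trans_eq ?_
  rw [trace_conjTranspose_mul_eq_sum, gramForm, Finset.sum_comm]
  simp only [reshuffle_apply_apply, Matrix.conjTranspose_single, star_one,
    Matrix.single_mul_single_same, mul_one, dotProduct, Matrix.mulVec, Pi.star_apply, star_star,
    Finset.mul_sum]
  refine Finset.sum_congr rfl fun i _ => ?_
  have hswap : ∀ f : Fin n → Fin n → Fin n → ℂ,
      ∑ p, ∑ b, ∑ j, f p b j = ∑ j, ∑ p, ∑ b, f p b j := fun f => by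
    rw [Finset.sum_comm (s := Finset.univ) (f := fun j p => ∑ b, f p b j)]
    exact Finset.sum_congr rfl fun p _ => Finset.sum_comm
  rw [hswap]
  refine Finset.sum_congr rfl fun j _ => Finset.sum_congr rfl fun p _ =>
    Finset.sum_congr rfl fun b _ => ?_
  ring

/-- The bilinear map `(u, v) ↦ v * B * F u`. -/
noncomputable def mulBilinRev (F : 𝕄 →ₗ[ℂ] 𝕄) (B : 𝕄) : 𝕄 →ₗ[ℂ] 𝕄 →ₗ[ℂ] 𝕄 :=
  (mulBilin LinearMap.id B).flip ∘ₗ F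

theorem mulBilinRev_apply (F : 𝕄 →ₗ[ℂ] 𝕄) (B u v : 𝕄) : mulBilinRev F B u v = v * B * F u := by
  simp [mulBilinRev, mulBilin_apply]

/-- The reshuffling of a map that commutes with the modular operator commutes with it. -/
theorem reshuffle_modular {σ : 𝕄} (hσ : σ.PosDef) {F : 𝕄 →ₗ[ℂ] 𝕄}
    (hF : ∀ x, F (σ * x * σ⁻¹) = σ * F x * σ⁻¹) (y : 𝕄) :
    reshuffle F (σ * y * σ⁻¹) = σ * reshuffle F y * σ⁻¹ := by
  have hu := isUnit_det_of_posDef hσ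
  obtain ⟨S, hS⟩ := exists_isStarBasis_starSubalgebra (⊤ : StarSubalgebra ℂ 𝕄)
  have h1 := hS.casimir_left (mulBilinRev (F ∘ₗ LinearMap.mulRight ℂ σ⁻¹) (y * σ⁻¹)) (a := σ)
    StarSubalgebra.mem_top
  have h2 := hS.casimir_right (mulBilinRev (F ∘ₗ LinearMap.mulRight ℂ σ⁻¹) (σ * y * σ⁻¹)) (a := σ)
    StarSubalgebra.mem_top
  simp only [mulBilinRev_apply, LinearMap.comp_apply, LinearMap.mulRight_apply,
    Matrix.mul_nonsing_inv_cancel_right _ _ hu, hF] at h1 h2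
  rw [reshuffle_eq_sum hS, reshuffle_eq_sum hS, h2, Matrix.mul_sum, Matrix.sum_mul]
  have h3 := congrArg (σ * ·) h1
  simp only [Matrix.mul_sum, Matrix.mul_assoc, Matrix.nonsing_inv_mul_cancel_left _ _ hu] at h3 ⊢
  exact h3.symm

/-- For a Hermitian map that is symmetric for `tr (· σ)`, the adjoint intertwines the reshuffling
with its composition with the inverse modular operator. -/
theorem reshuffle_conjTranspose {σ : 𝕄} (hσ : σ.PosDef) {F : 𝕄 →ₗ[ℂ] 𝕄}
    (hF : ∀ x y, (F x * y * σ).trace = (x * F y * σ).trace) (hFs : ∀ x, F xᴴ = (F x)ᴴ) (y : 𝕄) :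
    reshuffle F yᴴ = (reshuffle F (σ⁻¹ * y * σ))ᴴ := by
  have hu := isUnit_det_of_posDef hσ
  obtain ⟨S, hS⟩ := exists_isStarBasis_starSubalgebra (⊤ : StarSubalgebra ℂ 𝕄)
  set B := σ * yᴴ * σ⁻¹ with hB
  have h1 : (reshuffle F (σ⁻¹ * y * σ))ᴴ = ∑ x ∈ S, F xᴴ * B * x := by
    rw [reshuffle_eq_sum hS, Matrix.conjTranspose_sum]
    refine Finset.sum_congr rfl fun x _ => ?_
    rw [hFs, hB]
    simp only [Matrix.conjTranspose_mul, Matrix.conjTranspose_conjTranspose,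
      Matrix.conjTranspose_nonsing_inv, hσ.isHermitian.eq, Matrix.mul_assoc]
  have h2 : ∑ x ∈ S, F xᴴ * B * x = ∑ u ∈ S, uᴴ * B * (F (u * σ⁻¹) * σ) := by
    have e1 : ∀ x ∈ S, F xᴴ * B * x = ∑ u ∈ S, (F xᴴ * u).trace • (uᴴ * B * x) := by
      intro x _
      conv_lhs => rw [hS.expand_conjTranspose (y := F xᴴ) StarSubalgebra.mem_top]
      simp only [Matrix.sum_mul, Matrix.smul_mul]
    have e2 : ∀ u ∈ S, uᴴ * B * (F (u * σ⁻¹) * σ) =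
        ∑ x ∈ S, (xᴴ * (F (u * σ⁻¹) * σ)).trace • (uᴴ * B * x) := by
      intro u _
      conv_lhs => rw [hS.expand' (y := F (u * σ⁻¹) * σ) StarSubalgebra.mem_top]
      simp only [Matrix.mul_sum, Matrix.mul_smul]
    rw [Finset.sum_congr rfl e1, Finset.sum_congr rfl e2, Finset.sum_comm]
    refine Finset.sum_congr rfl fun u _ => Finset.sum_congr rfl fun x _ => ?_
    congr 1
    rw [← Matrix.mul_assoc, ← hF, ← Matrix.mul_assoc, Matrix.nonsing_inv_mul_cancel_right _ _ hu]
  have h3 := hS.casimir_right (mulBilinRev F B) (a := σ⁻¹) StarSubalgebra.mem_top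
  simp only [mulBilinRev_apply] at h3
  have h4 : ∑ u ∈ S, uᴴ * B * (F (u * σ⁻¹) * σ) = σ⁻¹ * reshuffle F B * σ := by
    rw [reshuffle_eq_sum hS, Matrix.mul_sum, Matrix.sum_mul]
    simp only [← Matrix.mul_assoc, ← Matrix.sum_mul] at h3 ⊢
    rw [h3]
  rw [h1, h2, h4, hB, reshuffle_modular hσ (map_modular_of_symmetric hσ hF), ← Matrix.mul_assoc,
    Matrix.nonsing_inv_mul_cancel_right _ _ hu, Matrix.nonsing_inv_mul_cancel_left _ _ hu]

end Reshuffle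

/-! ### Alicki's form of a detailed balance generator -/

section Alicki

/-- The orthogonal projection onto the matrices of trace `0`. -/
noncomputable def tracelessProj : 𝕄 →ₗ[ℂ] 𝕄 :=
  LinearMap.id - ((n : ℂ)⁻¹ • Matrix.traceLinearMap (Fin n) ℂ ℂ).smulRight (1 : 𝕄)

theorem tracelessProj_apply (y : 𝕄) : tracelessProj y = y - ((n : ℂ)⁻¹ * y.trace) • (1 : 𝕄) := by
  simp [tracelessProj]

theorem trace_tracelessProj (hn : (n : ℂ) ≠ 0) (y : 𝕄) : (tracelessProj y).trace = 0 := by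
  rw [tracelessProj_apply, Matrix.trace_sub, Matrix.trace_smul, Matrix.trace_one, Fintype.card_fin,
    smul_eq_mul, mul_right_comm, inv_mul_cancel₀ hn, one_mul, sub_self]

theorem tracelessProj_conjTranspose (y : 𝕄) : tracelessProj yᴴ = (tracelessProj y)ᴴ := by
  simp [tracelessProj_apply, Matrix.trace_conjTranspose]

theorem tracelessProj_symmetric (x y : 𝕄) :
    ((tracelessProj x)ᴴ * y).trace = (xᴴ * tracelessProj y).trace := by
  rw [← tracelessProj_conjTranspose]
  simp only [tracelessProj_apply, sub_mul, mul_sub, Matrix.trace_sub, Matrix.smul_mul,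
    Matrix.mul_smul, Matrix.one_mul, Matrix.mul_one, Matrix.trace_smul, smul_eq_mul]
  ring

theorem tracelessProj_conj {a b : 𝕄} (hab : a * b = 1) (y : 𝕄) :
    tracelessProj (a * y * b) = a * tracelessProj y * b := by
  rw [tracelessProj_apply, tracelessProj_apply, Matrix.trace_mul_comm, ← Matrix.mul_assoc,
    mul_eq_one_comm.1 hab, Matrix.one_mul, mul_sub, sub_mul, Matrix.mul_smul, Matrix.smul_mul,
    Matrix.mul_one, hab]

/-- The generator of a detailed balance semigroup on all matrices in Alicki's form, written with
the weights `d v` and modular eigenvalues `r v`. -/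
theorem IsDetailedBalanceForm.exists_eigenvectors {σ k : 𝕄} {Ψ : 𝕄 →ₗ[ℂ] 𝕄} (hn : (n : ℂ) ≠ 0)
    (hσ : σ.PosDef) (h : IsDetailedBalanceForm σ k Ψ) (h1 : k + k + Ψ 1 = 0) :
    ∃ (S : Finset 𝕄) (d r : 𝕄 → ℝ), (∀ v ∈ S, 0 < d v) ∧ (∀ v ∈ S, 0 < r v) ∧
      (∀ v ∈ S, v.trace = 0) ∧
      (∀ v ∈ S, ∀ w ∈ S, (vᴴ * w).trace = if v = w then 1 else 0) ∧ (∀ v ∈ S, vᴴ ∈ S) ∧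
      (∀ v ∈ S, σ * v * σ⁻¹ = (r v : ℂ) • v) ∧
      ∀ x, -(k * x + x * k + Ψ x) = ∑ v ∈ S, ((d v / 2 : ℝ) : ℂ) •
        (vᴴ * ⁅v, x⁆ - (((r v)⁻¹ : ℝ) : ℂ) • (⁅v, x⁆ * vᴴ)) := by
  classical
  have hu := isUnit_det_of_posDef hσ
  set T := reshuffle Ψ with hT
  set T₀ : 𝕄 →ₗ[ℂ] 𝕄 := tracelessProj ∘ₗ T ∘ₗ tracelessProj with hT₀
  have hT₀a : ∀ y, T₀ y = tracelessProj (T (tracelessProj y)) := fun y => rfl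
  have hTsym := reshuffle_symmetric h.map_conjTranspose
  have hTσ := reshuffle_modular hσ (map_modular_of_symmetric hσ h.symmetric)
  have hTs := reshuffle_conjTranspose hσ h.symmetric h.map_conjTranspose
  have hsym : ∀ x y, ((T₀ x)ᴴ * y).trace = (xᴴ * T₀ y).trace := fun x y => by
    rw [hT₀a, hT₀a, tracelessProj_symmetric, hTsym, tracelessProj_symmetric]
  have hmod : ∀ y, T₀ (σ * y * σ⁻¹) = σ * T₀ y * σ⁻¹ := fun y => by
    rw [hT₀a, hT₀a, tracelessProj_conj (Matrix.mul_nonsing_inv _ hu), hTσ,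
      tracelessProj_conj (Matrix.mul_nonsing_inv _ hu)]
  have hstar : ∀ y, T₀ yᴴ = (T₀ (σ⁻¹ * y * σ))ᴴ := fun y => by
    rw [hT₀a, hT₀a, tracelessProj_conjTranspose, hTs, tracelessProj_conjTranspose,
      tracelessProj_conj (Matrix.nonsing_inv_mul _ hu)]
  have hpos : ∀ y, 0 ≤ (yᴴ * T₀ y).trace := fun y => by
    rw [hT₀a, ← tracelessProj_symmetric]
    exact reshuffle_nonneg (fun ξ a => h.gramForm_nonneg ξ a) _
  obtain ⟨S, hS, hST, hSσ⟩ := exists_isStarBasis_eigenvectors hσ T₀ hsym hmod hstar ⊤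
    (by simp) (by simp) (by simp)
  let d : 𝕄 → ℝ := fun v => (vᴴ * T₀ v).trace.re
  have hd0 : ∀ v, 0 ≤ d v := fun v => (Complex.nonneg_iff.1 (hpos v)).1
  have hdc : ∀ v, ((d v : ℝ) : ℂ) = (vᴴ * T₀ v).trace := fun v =>
    Complex.ext rfl (by simpa using (Complex.nonneg_iff.1 (hpos v)).2)
  have hunit : ∀ v ∈ S, (vᴴ * v).trace = 1 := fun v hv => by
    rw [hS.orthonormal v hv v hv, if_pos rfl]
  have hdv : ∀ v ∈ S, ∀ c : ℂ, T₀ v = c • v → (d v : ℂ) = c := fun v hv c hc => by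
    rw [hdc, hc, Matrix.mul_smul, Matrix.trace_smul, hunit v hv, smul_eq_mul, mul_one]
  have hTd : ∀ v ∈ S, T₀ v = (d v : ℂ) • v := fun v hv => by
    obtain ⟨c, hc⟩ := hST v hv
    rw [hdv v hv c hc, hc]
  choose! r hr hrσ using hSσ
  have hdstar : ∀ v ∈ S, d vᴴ = (r v)⁻¹ * d v := fun v hv => by
    have e : T₀ vᴴ = (((r v)⁻¹ * d v : ℝ) : ℂ) • vᴴ := by
      rw [hstar, (modular_conjTranspose hσ (hr v hv).ne' (hrσ v hv)).2, map_smul, hTd v hv,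
        smul_smul, Matrix.conjTranspose_smul, ← Complex.ofReal_mul, Complex.star_def,
        Complex.conj_ofReal]
    exact_mod_cast hdv _ (hS.star_mem v hv) _ e
  let S' := S.filter fun v => d v ≠ 0
  have hS' : ∀ v, v ∈ S' ↔ v ∈ S ∧ d v ≠ 0 := fun v => Finset.mem_filter
  have hstar' : ∀ v ∈ S', vᴴ ∈ S' := fun v hv => by
    rw [hS'] at hv ⊢
    exact ⟨hS.star_mem v hv.1, by
      rw [hdstar v hv.1]; exact mul_ne_zero (inv_ne_zero (hr v hv.1).ne') hv.2⟩
  -- the completely positive part in Kraus form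
  set Ψ₀ := reshuffle T₀ with hΨ₀
  have hT₀sum : T₀ = ∑ v ∈ S', (d v : ℂ) • traceRankOne vᴴ v := by
    refine LinearMap.ext fun y => ?_
    conv_lhs => rw [hS.expand y (Submodule.mem_top)]
    rw [map_sum, LinearMap.sum_apply, Finset.sum_filter]
    refine Finset.sum_congr rfl fun v hv => ?_
    rw [map_smul, hTd v hv, LinearMap.smul_apply, traceRankOne_apply]
    split_ifs with h0
    · rw [smul_comm]
    · rw [not_not.1 h0]; simp
  have hKraus : ∀ x, Ψ₀ x = ∑ v ∈ S', (d v : ℂ) • (vᴴ * x * v) := fun x => by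
    rw [hΨ₀, hT₀sum, map_sum, LinearMap.sum_apply]
    exact Finset.sum_congr rfl fun v _ => by
      rw [map_smul, LinearMap.smul_apply, reshuffle_traceRankOne]
  have hKraus' : ∀ x, Ψ₀ x = ∑ v ∈ S', ((d v : ℂ) * (((r v)⁻¹ : ℝ) : ℂ)) • (v * x * vᴴ) := by
    intro x
    rw [hKraus]
    refine Finset.sum_nbij' (fun v => vᴴ) (fun v => vᴴ) hstar' hstar' (by simp) (by simp) ?_
    intro v hv
    have hvS := ((hS' v).1 hv).1
    have e1 := hdstar _ (hS.star_mem v hvS)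
    rw [Matrix.conjTranspose_conjTranspose] at e1
    rw [Matrix.conjTranspose_conjTranspose, e1]
    push_cast
    rw [mul_comm]
  -- removing the trace from the eigenvectors only changes the drift
  set w := T 1 with hw
  have hws : wᴴ = w := by
    have := hTs 1
    rw [Matrix.conjTranspose_one, Matrix.mul_one, Matrix.nonsing_inv_mul _ hu] at this
    rw [hw, ← this]
  have hTtr : ∀ y, (T y).trace = (w * y).trace := fun y => by
    have := hTsym 1 y
    rw [Matrix.conjTranspose_one, Matrix.one_mul] at this
    rw [← this, ← hT, ← hw, hws]
  obtain ⟨g, hg⟩ : ∃ g : 𝕄, g = k + (n : ℂ)⁻¹ • w - ((n : ℂ)⁻¹ ^ 2 / 2 * w.trace) • (1 : 𝕄) :=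
    ⟨_, rfl⟩
  have hTT₀ : T = T₀ + (n : ℂ)⁻¹ • (traceRankOne w 1 + traceRankOne 1 w) -
      ((n : ℂ)⁻¹ ^ 2 * w.trace) • traceRankOne 1 1 := by
    refine LinearMap.ext fun y => ?_
    simp only [LinearMap.sub_apply, LinearMap.add_apply, LinearMap.smul_apply, traceRankOne_apply,
      hT₀a, tracelessProj_apply, map_sub, map_smul, ← hw, hTtr,
      Matrix.one_mul]
    module
  have hform : ∀ x, k * x + x * k + Ψ x = g * x + x * g + Ψ₀ x := by
    intro x
    have e1 : Ψ = reshuffle T := (reshuffle_reshuffle Ψ).symm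
    have e2 : Ψ x = Ψ₀ x + (n : ℂ)⁻¹ • (w * x + x * w) - ((n : ℂ)⁻¹ ^ 2 * w.trace) • x := by
      rw [e1, hTT₀]
      simp only [map_sub, map_add, map_smul, LinearMap.sub_apply, LinearMap.add_apply,
        LinearMap.smul_apply, reshuffle_traceRankOne, Matrix.one_mul, Matrix.mul_one]
      rfl
    rw [e2, hg]
    simp only [sub_mul, add_mul, mul_sub, mul_add, Matrix.smul_mul, Matrix.mul_smul, Matrix.one_mul,
      Matrix.mul_one]
    module
  have hg1 : g = -((1 / 2 : ℂ) • Ψ₀ 1) := by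
    have := hform 1
    rw [Matrix.mul_one, Matrix.one_mul, h1, Matrix.mul_one, Matrix.one_mul] at this
    have e : Ψ₀ 1 = -(g + g) := (neg_eq_of_add_eq_zero_right this.symm).symm
    rw [e]; module
  refine ⟨S', d, r, fun v hv => lt_of_le_of_ne (hd0 v) (((hS' v).1 hv).2).symm,
    fun v hv => hr v ((hS' v).1 hv).1, ?_, fun v hv w hw =>
      hS.orthonormal v ((hS' v).1 hv).1 w ((hS' w).1 hw).1, hstar',
    fun v hv => hrσ v ((hS' v).1 hv).1, ?_⟩
  · intro v hv
    have e := congrArg Matrix.trace (hTd v ((hS' v).1 hv).1)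
    rw [hT₀a, trace_tracelessProj hn, Matrix.trace_smul, smul_eq_mul] at e
    exact (mul_eq_zero.1 e.symm).resolve_left (by exact_mod_cast ((hS' v).1 hv).2)
  · intro x
    have e1 : -(k * x + x * k + Ψ x) = (1 / 2 : ℂ) • (Ψ₀ 1 * x) + (1 / 2 : ℂ) • (x * Ψ₀ 1) -
        (1 / 2 : ℂ) • Ψ₀ x - (1 / 2 : ℂ) • Ψ₀ x := by
      rw [hform, hg1, neg_mul, mul_neg, Matrix.smul_mul, Matrix.mul_smul]
      module
    rw [e1]
    nth_rw 1 [hKraus 1]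
    rw [hKraus' 1]
    nth_rw 1 [hKraus x]
    rw [hKraus' x]
    simp only [Matrix.sum_mul, Matrix.mul_sum, Finset.smul_sum, ← Finset.sum_add_distrib,
      ← Finset.sum_sub_distrib]
    refine Finset.sum_congr rfl fun v _ => ?_
    rw [Ring.lie_def]
    simp only [Matrix.mul_one, Matrix.smul_mul, Matrix.mul_smul, mul_sub, sub_mul,
      ← Matrix.mul_assoc]
    push_cast
    module

/-- Alicki's theorem for a Lindblad form with detailed balance that annihilates `1`. -/
theorem IsDetailedBalanceForm.exists_alicki {σ k : 𝕄} {Ψ : 𝕄 →ₗ[ℂ] 𝕄} (hn : (n : ℂ) ≠ 0)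
    (hσ : σ.PosDef) (h : IsDetailedBalanceForm σ k Ψ) (h1 : k + k + Ψ 1 = 0) :
    ∃ (m : ℕ) (ω c : Fin m → ℝ) (v : Fin m → 𝕄),
        (∀ j, 0 < c j) ∧
        (∀ j, (v j).trace = 0) ∧
        (∀ j k, ((v j)ᴴ * v k).trace = if j = k then 1 else 0) ∧
        (Set.range v = Set.range fun j => (v j)ᴴ) ∧
        (∀ j, σ * v j * σ⁻¹ = (Real.exp (-ω j) : ℂ) • v j) ∧
        ∀ x, -(k * x + x * k + Ψ x) = ∑ j, (c j : ℂ) •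
              ((Real.exp (-ω j / 2) : ℂ) • ((v j)ᴴ * ⁅v j, x⁆) -
                (Real.exp (ω j / 2) : ℂ) • (⁅v j, x⁆ * (v j)ᴴ)) := by
  obtain ⟨S, d, r, hd, hr, htr, ho, hs, hσv, hx⟩ := h.exists_eigenvectors hn hσ h1
  let e := S.equivFin.symm
  refine ⟨S.card, fun j => -Real.log (r (e j)),
    fun j => d (e j) / 2 * Real.exp (-Real.log (r (e j)) / 2), fun j => (e j : 𝕄),
    fun j => mul_pos (half_pos (hd _ (e j).2)) (Real.exp_pos _), fun j => htr _ (e j).2,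
    ?_, ?_, ?_, ?_⟩
  · intro i j
    rw [ho _ (e i).2 _ (e j).2]
    simp only [Subtype.coe_inj, e.injective.eq_iff]
  · have hrange : Set.range (fun j => (e j : 𝕄)) = S := by
      ext v
      constructor
      · rintro ⟨j, rfl⟩; exact (e j).2
      · intro hv; exact ⟨e.symm ⟨v, hv⟩, by simp⟩
    have hrange' : Set.range (fun j => (e j : 𝕄)ᴴ) = S := by
      ext v
      constructor
      · rintro ⟨j, rfl⟩; exact hs _ (e j).2
      · intro hv; exact ⟨e.symm ⟨vᴴ, hs v hv⟩, by simp⟩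
    rw [hrange, hrange']
  · intro j
    rw [neg_neg, Real.exp_log (hr _ (e j).2), hσv _ (e j).2]
  · intro x
    rw [hx, ← Finset.sum_coe_sort, ← Equiv.sum_comp e]
    refine Finset.sum_congr rfl fun j _ => ?_
    have hr0 := hr _ (e j).2
    have e1 : d (e j) / 2 * Real.exp (-Real.log (r (e j)) / 2) *
        Real.exp (- -Real.log (r (e j)) / 2) = d (e j) / 2 := by
      rw [mul_assoc, ← Real.exp_add, neg_neg, neg_div, neg_add_cancel, Real.exp_zero, mul_one]
    have e2 : d (e j) / 2 * Real.exp (-Real.log (r (e j)) / 2) *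
        Real.exp (-Real.log (r (e j)) / 2) = d (e j) / 2 * (r (e j))⁻¹ := by
      rw [mul_assoc, ← Real.exp_add, add_halves, Real.exp_neg, Real.exp_log hr0]
    rw [smul_sub, smul_sub, smul_smul, smul_smul, smul_smul, ← Complex.ofReal_mul,
      ← Complex.ofReal_mul, ← Complex.ofReal_mul, e1, e2]

end Alicki

/-! ### One-parameter semigroups in finite dimensions -/

section OneParameterSemigroup

variable {A : Type*} [NormedRing A]

/-- A one-parameter semigroup in a Banach algebra that is norm continuous at `0` is norm
continuous. -/
theorem continuous_of_semigroup {P : ℝ≥0 → A} (h0 : P 0 = 1) (hadd : ∀ s t, P s * P t = P (s + t))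
    (hlim : Tendsto P (𝓝[>] 0) (𝓝 1)) : Continuous P := by
  have hc0 : Tendsto P (𝓝 0) (𝓝 1) := by
    have : (𝓝 (0 : ℝ≥0)) = pure 0 ⊔ 𝓝[>] 0 := by
      rw [← pure_sup_nhdsNE]
      congr 2
      ext x
      simp [pos_iff_ne_zero]
    rw [this]
    exact Tendsto.sup (by rw [← h0]; exact tendsto_pure_nhds P 0) hlim
  have hpow : ∀ (N : ℕ) (s : ℝ≥0), P (N * s) = P s ^ N := fun N s => by
    induction N with
    | zero => simp [h0]
    | succ N ih => rw [pow_succ, ← ih, hadd, Nat.cast_succ, add_mul, one_mul]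
  obtain ⟨δ, hδ, hδP⟩ : ∃ δ : ℝ≥0, 0 < δ ∧ ∀ s < δ, ‖P s‖ < ‖(1 : A)‖ + 1 := by
    have h1 : ∀ᶠ s in 𝓝 (0 : ℝ≥0), ‖P s‖ < ‖(1 : A)‖ + 1 :=
      hc0.norm.eventually_lt_const (lt_add_one _)
    obtain ⟨δ, hδ, h⟩ := Metric.eventually_nhds_iff.1 h1
    refine ⟨⟨δ, hδ.le⟩, hδ, fun s hs => h ?_⟩
    rw [NNReal.dist_eq, NNReal.coe_zero, sub_zero]
    exact (abs_of_nonneg s.2).trans_lt hs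
  -- local boundedness
  have hbdd : ∀ t : ℝ≥0, ∃ C, ∀ s ≤ t, ‖P s‖ ≤ C := by
    intro t
    obtain ⟨N, hN⟩ := exists_nat_gt (t / δ)
    have hN0 : (0 : ℝ≥0) < N := lt_of_le_of_lt zero_le hN
    have hN0' : 0 < N := by exact_mod_cast hN0
    refine ⟨(‖(1 : A)‖ + 1) ^ N, fun s hs => ?_⟩
    have h2 : s / N < δ := by
      rw [div_lt_iff₀ hN0, mul_comm, ← div_lt_iff₀ hδ]
      exact lt_of_le_of_lt (by gcongr) hN
    have h3 : P s = P (s / N) ^ N := by rw [← hpow, mul_div_cancel₀ _ hN0.ne']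
    rw [h3]
    exact (norm_pow_le' _ hN0').trans (by gcongr; exact (hδP _ h2).le)
  have hdiff : ∀ s t C, (∀ u ≤ max s t, ‖P u‖ ≤ C) →
      ‖P s - P t‖ ≤ C * ‖P (nndist s t) - 1‖ := by
    have key : ∀ s t C, s ≤ t → (∀ u ≤ t, ‖P u‖ ≤ C) → ‖P t - P s‖ ≤ C * ‖P (nndist s t) - 1‖ := by
      intro s t C hst hC
      have e : P t - P s = P s * (P (nndist s t) - 1) := by
        rw [mul_sub, mul_one, hadd, NNReal.nndist_eq, tsub_eq_zero_of_le hst, max_eq_right zero_le,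
          add_tsub_cancel_of_le hst]
      rw [e]
      exact (norm_mul_le _ _).trans (mul_le_mul_of_nonneg_right (hC s hst) (norm_nonneg _))
    intro s t C hC
    rcases le_total s t with h | h
    · rw [norm_sub_rev]; exact key s t C h (by rwa [max_eq_right h] at hC)
    · rw [nndist_comm]; exact key t s C h (by rwa [max_eq_left h] at hC)
  refine continuous_iff_continuousAt.2 fun t => ?_
  obtain ⟨C, hC⟩ := hbdd (t + 1)
  have h4 : Tendsto (fun s => C * ‖P (nndist s t) - 1‖) (𝓝 t) (𝓝 0) := by
    have h5 : Tendsto (fun s => nndist s t) (𝓝 t) (𝓝 0) := by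
      have : Continuous fun s => nndist s t := by fun_prop
      simpa using this.tendsto t
    simpa using ((hc0.comp h5).sub_const 1).norm.const_mul C
  rw [ContinuousAt, tendsto_iff_norm_sub_tendsto_zero]
  refine squeeze_zero' (Eventually.of_forall fun _ => norm_nonneg _) ?_ h4
  filter_upwards [eventually_le_nhds (lt_add_one t)] with s hs
  exact hdiff s t C fun u hu => hC u (hu.trans (max_le hs (le_add_of_nonneg_right zero_le_one)))

variable [NormedAlgebra ℝ A] [CompleteSpace A]

/-- The generator is read off from the identity `P t * ∫₀^ε P = ∫_t^(t+ε) P`, in which the integral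
on the left is invertible for small `ε` and the right side is differentiable in `t`. -/
theorem exists_eq_exp_of_semigroup {P : ℝ≥0 → A} (h0 : P 0 = 1)
    (hadd : ∀ s t, P s * P t = P (s + t)) (hlim : Tendsto P (𝓝[>] 0) (𝓝 1)) :
    ∃ G : A, ∀ t : ℝ≥0, P t = NormedSpace.exp ((t : ℝ) • G) := by
  have hcont := continuous_of_semigroup h0 hadd hlim
  set p : ℝ → A := fun t => P t.toNNReal with hp
  have hpc : Continuous p := hcont.comp continuous_real_toNNReal
  have hp0 : p 0 = 1 := by simp [hp, h0]
  have hpadd : ∀ s t, 0 ≤ s → 0 ≤ t → p s * p t = p (s + t) := fun s t hs ht => by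
    simp only [hp]; rw [hadd, Real.toNNReal_add hs ht]
  set F : ℝ → A := fun t => ∫ s in (0 : ℝ)..t, p s with hF
  have hFd : ∀ t, HasDerivAt F (p t) t := fun t =>
    intervalIntegral.integral_hasDerivAt_right (hpc.intervalIntegrable _ _)
      hpc.aestronglyMeasurable.stronglyMeasurableAtFilter hpc.continuousAt
  have hF0 : F 0 = 0 := by simp [hF]
  obtain ⟨ε, hε, J, hJ⟩ : ∃ ε : ℝ, 0 < ε ∧ ∃ J, F ε * J = 1 := by
    have h1 := (hasDerivAt_iff_tendsto_slope_zero.1 (hFd 0)).mono_left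
      (nhdsWithin_mono (0 : ℝ) (s := Set.Ioi 0) fun x hx => ne_of_gt hx)
    simp only [zero_add, hF0, sub_zero, hp0] at h1
    have h2 : ∀ᶠ t in 𝓝[>] (0 : ℝ), IsUnit (t⁻¹ • F t) :=
      h1.eventually (Units.isOpen.mem_nhds isUnit_one)
    obtain ⟨ε, hε1, hε2⟩ := (h2.and self_mem_nhdsWithin).exists
    obtain ⟨J, hJ⟩ := hε1.exists_right_inv
    exact ⟨ε, hε2, ε⁻¹ • J, by rw [mul_smul_comm, ← smul_mul_assoc, hJ]⟩
  have hpF : ∀ t, 0 ≤ t → p t = (F (t + ε) - F t) * J := by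
    intro t ht
    have : p t * F ε = F (t + ε) - F t := by
      have hmul := (ContinuousLinearMap.mul ℝ A (p t)).intervalIntegral_comp_comm
        (hpc.intervalIntegrable (μ := MeasureTheory.volume) 0 ε)
      simp only [ContinuousLinearMap.mul_apply'] at hmul
      rw [hF]
      simp only
      rw [← hmul, intervalIntegral.integral_interval_sub_left
        (hpc.intervalIntegrable _ _) (hpc.intervalIntegrable _ _)]
      rw [show ∫ s in t..t + ε, p s = ∫ s in t + 0..t + ε, p s by rw [add_zero],
        ← intervalIntegral.integral_comp_add_left]
      refine intervalIntegral.integral_congr fun s hs => ?_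
      rw [Set.uIcc_of_le hε.le] at hs
      exact hpadd t s ht hs.1
    rw [← this, mul_assoc, hJ, mul_one]
  set G := (p ε - 1) * J with hG
  set q : ℝ → A := fun t => (F (t + ε) - F t) * J with hq
  have hqd : ∀ t, 0 ≤ t → HasDerivAt q (q t * G) t := by
    intro t ht
    have h1 : HasDerivAt q ((p (t + ε) - p t) * J) t :=
      (((hFd (t + ε)).comp_add_const t ε).sub (hFd t)).mul_const J
    convert h1 using 1
    rw [hq]
    simp only
    rw [← hpF t ht, hG, ← mul_assoc, mul_sub, mul_one, hpadd t ε ht hε.le]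
  refine ⟨G, fun t => ?_⟩
  have hd : ∀ s, 0 ≤ s → HasDerivAt (fun s : ℝ => q s * NormedSpace.exp (s • -G)) 0 s := by
    intro s hs
    have := (hqd s hs).mul (hasDerivAt_exp_smul_const' (𝕂 := ℝ) (-G) s)
    rw [show q s * G * NormedSpace.exp (s • -G) + q s * (-G * NormedSpace.exp (s • -G)) = 0 by
      noncomm_ring] at this
    exact this
  have hconst := constant_of_has_deriv_right_zero (a := 0) (b := (t : ℝ))
    (f := fun s : ℝ => q s * NormedSpace.exp (s • -G))
    (fun s hs => (hd s hs.1).continuousAt.continuousWithinAt)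
    (fun s hs => (hd s hs.1).hasDerivWithinAt) t ⟨t.2, le_rfl⟩
  have hq0 : q 0 = 1 := by rw [← hp0, hpF 0 le_rfl]
  simp only [zero_smul, NormedSpace.exp_zero, mul_one, hq0] at hconst
  have hqt : P t = q t := by
    have := hpF t t.2
    simpa [hp] using this
  rw [hqt]
  have hcomm : Commute ((t : ℝ) • -G) ((t : ℝ) • G) := by
    rw [smul_neg]; exact (Commute.refl _).neg_left
  calc q t = q t * (NormedSpace.exp ((t : ℝ) • -G) * NormedSpace.exp ((t : ℝ) • G)) := by
        let _ : NormedAlgebra ℚ A := NormedAlgebra.restrictScalars ℚ ℝ A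
        rw [← NormedSpace.exp_add_of_commute hcomm, smul_neg, neg_add_cancel, NormedSpace.exp_zero,
          mul_one]
    _ = _ := by rw [← mul_assoc, hconst, one_mul]

/-- The Euler approximations `(1 + (t/m) G + (t/m)² R)^m` with an arbitrary second order
perturbation converge to `exp (t G)`. -/
theorem tendsto_pow_exp (h1 : ‖(1 : A)‖ ≤ 1) (X Y : A) :
    Tendsto (fun m : ℕ => (1 + (m : ℝ)⁻¹ • X + ((m : ℝ)⁻¹ ^ 2) • Y) ^ m) atTop
      (𝓝 (NormedSpace.exp X)) := by
  let _ : NormedAlgebra ℚ A := NormedAlgebra.restrictScalars ℚ ℝ A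
  have hexp : Continuous fun s : ℝ => NormedSpace.exp (s • X) :=
    continuous_iff_continuousAt.2 fun s => (hasDerivAt_exp_smul_const (𝕂 := ℝ) X s).continuousAt
  obtain ⟨C, hC⟩ := (isCompact_Icc (a := (0 : ℝ)) (b := 1)).exists_bound_of_continuousOn
    hexp.continuousOn
  have hC0 : 0 ≤ C := (norm_nonneg _).trans (hC 0 (by simp))
  set D := ‖X‖ + ‖Y‖ with hD
  set a : ℕ → A := fun m => 1 + (m : ℝ)⁻¹ • X + ((m : ℝ)⁻¹ ^ 2) • Y with ha
  set b : ℕ → A := fun m => NormedSpace.exp ((m : ℝ)⁻¹ • X) with hb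
  have hbpow : ∀ m k : ℕ, b m ^ k = NormedSpace.exp (((k : ℝ) * (m : ℝ)⁻¹) • X) := fun m k => by
    rw [hb, ← NormedSpace.exp_nsmul, ← Nat.cast_smul_eq_nsmul ℝ, smul_smul]
  have hapow : ∀ m k : ℕ, 0 < m → k ≤ m → ‖a m ^ k‖ ≤ Real.exp D := by
    intro m k hm hk
    have hm' : (0 : ℝ) < m := by exact_mod_cast hm
    have hinv : (m : ℝ)⁻¹ ≤ 1 := inv_le_one_of_one_le₀ (by exact_mod_cast hm)
    have e1 : ‖a m‖ ≤ Real.exp ((m : ℝ)⁻¹ * D) := by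
      calc ‖a m‖ ≤ ‖(1 : A)‖ + ‖(m : ℝ)⁻¹ • X‖ + ‖((m : ℝ)⁻¹ ^ 2) • Y‖ := norm_add₃_le
        _ ≤ 1 + (m : ℝ)⁻¹ * ‖X‖ + (m : ℝ)⁻¹ * ‖Y‖ := by
            rw [norm_smul, norm_smul, Real.norm_of_nonneg (by positivity),
              Real.norm_of_nonneg (by positivity)]
            gcongr
            rw [sq]
            exact mul_le_of_le_one_left (by positivity) hinv
        _ = (m : ℝ)⁻¹ * D + 1 := by rw [hD]; ring
        _ ≤ _ := Real.add_one_le_exp _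
    have e2 : ‖a m ^ k‖ ≤ ‖a m‖ ^ k := by
      rcases Nat.eq_zero_or_pos k with rfl | h
      · simpa using h1
      · exact norm_pow_le' _ h
    calc ‖a m ^ k‖ ≤ Real.exp ((m : ℝ)⁻¹ * D) ^ k := e2.trans (by gcongr)
      _ = Real.exp (k * ((m : ℝ)⁻¹ * D)) := by rw [← Real.exp_nat_mul]
      _ ≤ Real.exp D := Real.exp_le_exp.2 (by
          rw [← mul_assoc]
          refine mul_le_of_le_one_left (by positivity) ?_
          rw [← div_eq_mul_inv, div_le_one hm']
          exact_mod_cast hk)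
  have hbound : ∀ m : ℕ, 0 < m →
      ‖a m ^ m - NormedSpace.exp X‖ ≤ Real.exp D * C * ‖(m : ℝ) • (a m - b m)‖ := by
    intro m hm
    have hm' : (0 : ℝ) < m := by exact_mod_cast hm
    have e0 : NormedSpace.exp X = b m ^ m := by
      rw [hbpow, mul_inv_cancel₀ hm'.ne', one_smul]
    have e1 : a m ^ m - b m ^ m =
        ∑ i ∈ Finset.range m, a m ^ i * (a m - b m) * b m ^ (m - (i + 1)) := by
      have := Finset.sum_range_sub (fun i => a m ^ i * b m ^ (m - i)) m
      simp only [Nat.sub_self, pow_zero, mul_one, one_mul, Nat.sub_zero] at this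
      rw [← this]
      refine Finset.sum_congr rfl fun i hi => ?_
      have : m - i = (m - (i + 1)) + 1 := by have := Finset.mem_range.1 hi; omega
      rw [this, pow_succ, pow_succ']
      noncomm_ring
    rw [e0, e1]
    refine (norm_sum_le _ _).trans ?_
    have e2 : ∀ i ∈ Finset.range m, ‖a m ^ i * (a m - b m) * b m ^ (m - (i + 1))‖ ≤
        Real.exp D * ‖a m - b m‖ * C := by
      intro i hi
      have hi' := Finset.mem_range.1 hi
      refine (norm_mul_le _ _).trans (mul_le_mul ((norm_mul_le _ _).trans
        (mul_le_mul_of_nonneg_right (hapow m i hm hi'.le) (norm_nonneg _))) ?_ (norm_nonneg _)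
        (by positivity))
      rw [hbpow]
      refine hC _ ⟨by positivity, ?_⟩
      rw [← div_eq_mul_inv, div_le_one hm']
      exact_mod_cast Nat.sub_le _ _
    refine (Finset.sum_le_sum e2).trans_eq ?_
    rw [Finset.sum_const, Finset.card_range, nsmul_eq_mul, norm_smul, Real.norm_of_nonneg hm'.le]
    ring
  have hinv : Tendsto (fun m : ℕ => (m : ℝ)⁻¹) atTop (𝓝[≠] 0) :=
    tendsto_nhdsWithin_iff.2 ⟨tendsto_inv_atTop_nhds_zero_nat, by
      filter_upwards [eventually_gt_atTop 0] with m hm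
      simp [hm.ne']⟩
  have hsmall : Tendsto (fun m : ℕ => (m : ℝ) • (a m - b m)) atTop (𝓝 0) := by
    have h2 := (hasDerivAt_iff_tendsto_slope_zero.1
      (hasDerivAt_exp_smul_const (𝕂 := ℝ) X 0)).comp hinv
    have h3 : Tendsto (fun m : ℕ => (m : ℝ)⁻¹ • Y) atTop (𝓝 ((0 : ℝ) • Y)) :=
      tendsto_inv_atTop_nhds_zero_nat.smul_const Y
    have h4 := (h3.add_const X).sub h2
    simp only [zero_smul, NormedSpace.exp_zero, one_mul, zero_add, sub_self] at h4
    refine h4.congr' ?_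
    filter_upwards [eventually_gt_atTop 0] with m hm
    have hm' : (m : ℝ) ≠ 0 := by exact_mod_cast hm.ne'
    simp only [Function.comp_apply, ha, hb, inv_inv, smul_sub, smul_add, smul_smul,
      mul_inv_cancel₀ hm', one_smul]
    rw [sq, ← mul_assoc, mul_inv_cancel₀ hm', one_mul]
    abel
  rw [tendsto_iff_norm_sub_tendsto_zero]
  refine squeeze_zero' (Eventually.of_forall fun _ => norm_nonneg _)
    ((eventually_gt_atTop 0).mono hbound) ?_
  simpa using hsmall.norm.const_mul (Real.exp D * C)

end OneParameterSemigroup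

section ExpSemigroup

/-- `P` is the one-parameter semigroup `t ↦ exp (t G)` of linear maps, described without reference
to a norm: by its slope at `0` and as the limit of its Euler approximations, which may carry an
arbitrary second order perturbation `R`. -/
structure IsExpSemigroup {V : Type*} [AddCommGroup V] [Module ℂ V] [TopologicalSpace V]
    (G : Module.End ℂ V) (P : ℝ≥0 → Module.End ℂ V) : Prop where
  zero : P 0 = 1
  add : ∀ s t, P s * P t = P (s + t)
  tendsto_zero : ∀ x, Tendsto (fun t => P t x) (𝓝[>] 0) (𝓝 x)
  tendsto_slope : ∀ x, Tendsto (fun t : ℝ≥0 => ((t : ℝ) : ℂ)⁻¹ • (P t x - x)) (𝓝[>] 0) (𝓝 (G x))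
  tendsto_euler : ∀ (R : Module.End ℂ V) (t : ℝ≥0) (x : V), Tendsto (fun m : ℕ =>
    ((1 + ((t / m : ℝ) : ℂ) • G + (((t / m) ^ 2 : ℝ) : ℂ) • R) ^ m) x) atTop (𝓝 (P t x))

variable {V : Type*} [NormedAddCommGroup V] [NormedSpace ℂ V] [FiniteDimensional ℂ V]

theorem tendsto_coe_nhdsGT_zero : Tendsto (fun t : ℝ≥0 => (t : ℝ)) (𝓝[>] 0) (𝓝[>] 0) :=
  tendsto_nhdsWithin_iff.2 ⟨(NNReal.continuous_coe.tendsto' 0 0 rfl).mono_left nhdsWithin_le_nhds,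
    by filter_upwards [self_mem_nhdsWithin] with t ht using ht⟩

theorem isExpSemigroup_of_eq_exp {G : Module.End ℂ V} {P : ℝ≥0 → Module.End ℂ V}
    (h : ∀ t : ℝ≥0, Module.End.toContinuousLinearMap V (P t) =
      NormedSpace.exp ((t : ℝ) • Module.End.toContinuousLinearMap V G)) : IsExpSemigroup G P := by
  have : CompleteSpace V := FiniteDimensional.complete ℂ V
  let Φ := Module.End.toContinuousLinearMap (𝕜 := ℂ) V
  have hΦ : ∀ (f : Module.End ℂ V) (x : V), Φ f x = f x := fun _ _ => rfl
  have hreal : ∀ (r : ℝ) (f : V →L[ℂ] V), (r : ℂ) • f = r • f := fun r f => by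
    ext x; simp
  have hslope : ∀ x, Tendsto (fun t : ℝ≥0 => ((t : ℝ) : ℂ)⁻¹ • (P t x - x)) (𝓝[>] 0)
      (𝓝 (G x)) := by
    intro x
    have h1 := (hasDerivAt_iff_tendsto_slope_zero.1
      (hasDerivAt_exp_smul_const (𝕂 := ℝ) (Φ G) 0)).mono_left
      (nhdsWithin_mono (0 : ℝ) (s := Set.Ioi 0) fun x hx => ne_of_gt hx)
    simp only [zero_add, zero_smul, NormedSpace.exp_zero, one_mul] at h1
    have h2 := ((ContinuousLinearMap.apply ℂ V x).continuous.tendsto _).comp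
      (h1.comp tendsto_coe_nhdsGT_zero)
    refine h2.congr fun t => ?_
    simp only [Function.comp_apply, ContinuousLinearMap.apply_apply]
    rw [← h t, ← hreal, Complex.ofReal_inv]
    rfl
  refine ⟨?_, ?_, ?_, hslope, ?_⟩
  · apply Φ.injective
    rw [h 0, map_one, NNReal.coe_zero, zero_smul, NormedSpace.exp_zero]
  · intro s t
    let _ : NormedAlgebra ℚ (V →L[ℂ] V) := NormedAlgebra.restrictScalars ℚ ℝ _
    apply Φ.injective
    rw [map_mul, h, h, h, NNReal.coe_add, add_smul]
    exact (NormedSpace.exp_add_of_commute (((Commute.refl (Φ G)).smul_left _).smul_right _)).symm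
  · intro x
    have h1 : Tendsto (fun t : ℝ≥0 => ((t : ℝ) : ℂ)) (𝓝[>] 0) (𝓝 0) :=
      ((Complex.continuous_ofReal.comp NNReal.continuous_coe).tendsto' 0 0 (by simp)).mono_left
        nhdsWithin_le_nhds
    have h2 := (h1.smul (hslope x)).add_const x
    rw [zero_smul, zero_add] at h2
    refine h2.congr' ?_
    filter_upwards [self_mem_nhdsWithin] with t ht
    have ht' : ((t : ℝ) : ℂ) ≠ 0 := by exact_mod_cast (ne_of_gt ht : t ≠ 0)
    rw [smul_smul, mul_inv_cancel₀ ht', one_smul, sub_add_cancel]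
  · intro R t x
    have h1 := tendsto_pow_exp (A := V →L[ℂ] V) ContinuousLinearMap.norm_id_le ((t : ℝ) • Φ G)
      (((t : ℝ) ^ 2) • Φ R)
    rw [← h t] at h1
    have h2 := ((ContinuousLinearMap.apply ℂ V x).continuous.tendsto _).comp h1
    refine h2.congr fun m => ?_
    simp only [Function.comp_apply, ContinuousLinearMap.apply_apply]
    rw [← hΦ, map_pow, map_add, map_add, map_one, map_smul, map_smul, hreal, hreal, smul_smul,
      smul_smul, div_eq_inv_mul, mul_pow]

theorem exists_isExpSemigroup (G : Module.End ℂ V) :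
    ∃ P : ℝ≥0 → Module.End ℂ V, IsExpSemigroup G P :=
  ⟨fun t => (Module.End.toContinuousLinearMap V).symm
      (NormedSpace.exp ((t : ℝ) • Module.End.toContinuousLinearMap V G)),
    isExpSemigroup_of_eq_exp fun t => by rw [AlgEquiv.apply_symm_apply]⟩

theorem exists_generator_of_semigroup {P : ℝ≥0 → Module.End ℂ V} (h0 : P 0 = 1)
    (hadd : ∀ s t, P s * P t = P (s + t)) (hlim : ∀ x, Tendsto (fun t => P t x) (𝓝[>] 0) (𝓝 x)) :
    ∃ G : Module.End ℂ V, IsExpSemigroup G P := by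
  have : CompleteSpace V := FiniteDimensional.complete ℂ V
  let Φ := Module.End.toContinuousLinearMap (𝕜 := ℂ) V
  -- pointwise convergence implies norm convergence in finite dimensions
  have hnorm : Tendsto (fun t => Φ (P t)) (𝓝[>] 0) (𝓝 1) := by
    let b := Module.finBasis ℂ V
    have hb : ∀ f : V →L[ℂ] V, f = ∑ i, ContinuousLinearMap.smulRightL ℂ V V
        (LinearMap.toContinuousLinearMap (b.coord i)) (f (b i)) := fun f => by
      ext x
      calc f x = ∑ i, b.repr x i • f (b i) := by
            conv_lhs => rw [← b.sum_repr x]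
            simp only [map_sum, map_smul]
        _ = _ := by simp
    have h1 : Tendsto (fun t => ∑ i, ContinuousLinearMap.smulRightL ℂ V V
        (LinearMap.toContinuousLinearMap (b.coord i)) (Φ (P t) (b i))) (𝓝[>] 0)
        (𝓝 (∑ i, ContinuousLinearMap.smulRightL ℂ V V
        (LinearMap.toContinuousLinearMap (b.coord i)) ((1 : V →L[ℂ] V) (b i)))) :=
      tendsto_finsetSum _ fun i _ =>
        ((ContinuousLinearMap.continuous _).tendsto _).comp (hlim (b i))
    rw [← hb] at h1
    exact h1.congr fun t => (hb _).symm
  obtain ⟨G, hG⟩ := exists_eq_exp_of_semigroup (P := fun t => Φ (P t)) (by rw [h0, map_one])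
    (fun s t => by rw [← map_mul, hadd]) hnorm
  exact ⟨Φ.symm G, isExpSemigroup_of_eq_exp fun t => by rw [AlgEquiv.apply_symm_apply]; exact hG t⟩

end ExpSemigroup

section MatrixSemigroup

/-- Matrices carry no global norm instance; the elementwise norm induces their topology. -/
theorem exists_isExpSemigroup_matrix (G : Module.End ℂ (Matrix (Fin n) (Fin n) ℂ)) :
    ∃ P : ℝ≥0 → Module.End ℂ (Matrix (Fin n) (Fin n) ℂ), IsExpSemigroup G P :=
  @exists_isExpSemigroup (Matrix (Fin n) (Fin n) ℂ) Matrix.normedAddCommGroup Matrix.normedSpace _ G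

theorem exists_generator_of_matrix_semigroup
    {P : ℝ≥0 → Module.End ℂ (Matrix (Fin n) (Fin n) ℂ)} (h0 : P 0 = 1)
    (hadd : ∀ s t, P s * P t = P (s + t)) (hlim : ∀ x, Tendsto (fun t => P t x) (𝓝[>] 0) (𝓝 x)) :
    ∃ G : Module.End ℂ (Matrix (Fin n) (Fin n) ℂ), IsExpSemigroup G P :=
  @exists_generator_of_semigroup (Matrix (Fin n) (Fin n) ℂ) Matrix.normedAddCommGroup
    Matrix.normedSpace _ P h0 hadd hlim

end MatrixSemigroup

/-! ### Complete positivity and Gram matrices -/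

section CompletePositivity

/-- A block matrix with entries `a i* a j` is positive. -/
theorem posSemidef_comp_gram {k : ℕ} (a : Fin k → 𝕄) :
    (Matrix.comp (Fin k) (Fin k) (Fin n) (Fin n) ℂ
      (Matrix.of fun i j => (a i)ᴴ * a j)).PosSemidef := by
  have : Matrix.comp (Fin k) (Fin k) (Fin n) (Fin n) ℂ (Matrix.of fun i j => (a i)ᴴ * a j) =
      (Matrix.of fun (r : Fin n) (p : Fin k × Fin n) => a p.1 r p.2)ᴴ *
        Matrix.of fun (r : Fin n) (p : Fin k × Fin n) => a p.1 r p.2 := by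
    ext p q
    simp [Matrix.comp_apply, Matrix.mul_apply]
  rw [this]
  exact Matrix.posSemidef_conjTranspose_mul_self _

theorem dotProduct_comp_mulVec {k : ℕ} (X : Matrix (Fin k) (Fin k) 𝕄) (v : Fin k × Fin n → ℂ) :
    star v ⬝ᵥ (Matrix.comp (Fin k) (Fin k) (Fin n) (Fin n) ℂ X *ᵥ v) =
      ∑ i, ∑ j, star (fun c => v (i, c)) ⬝ᵥ (X i j *ᵥ fun c => v (j, c)) := by
  simp only [dotProduct, Matrix.mulVec, Fintype.sum_prod_type, Matrix.comp_apply, Pi.star_apply,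
    Finset.mul_sum]
  refine Finset.sum_congr rfl fun i _ => ?_
  rw [Finset.sum_comm]

/-- A positive block matrix is a sum of block matrices with entries `a i* a j`. -/
theorem exists_gram_of_posSemidef {k : ℕ} {X : Matrix (Fin k) (Fin k) 𝕄}
    (hX : (Matrix.comp (Fin k) (Fin k) (Fin n) (Fin n) ℂ X).PosSemidef) :
    ∃ a : Fin k → Fin k → 𝕄, ∀ i j, X i j = ∑ l, (a l i)ᴴ * a l j := by
  obtain ⟨Y, hY⟩ : ∃ Y : Matrix (Fin k × Fin n) (Fin k × Fin n) ℂ,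
      Matrix.comp (Fin k) (Fin k) (Fin n) (Fin n) ℂ X = Yᴴ * Y := by
    open scoped MatrixOrder in
    have := CStarAlgebra.nonneg_iff_eq_star_mul_self.1 (Matrix.nonneg_iff_posSemidef.2 hX)
    exact this
  refine ⟨fun l i => Matrix.of fun c d => Y (l, c) (i, d), fun i j => ?_⟩
  ext c d
  have := congrFun (congrFun hY (i, c)) (j, d)
  rw [Matrix.comp_apply] at this
  rw [this, Matrix.sum_apply]
  simp [Matrix.mul_apply, Fintype.sum_prod_type]

/-- Complete positivity of a map on all matrices. -/
def IsCPMap (F : 𝕄 →ₗ[ℂ] 𝕄) : Prop :=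
  ∀ (k : ℕ) (X : Matrix (Fin k) (Fin k) 𝕄),
    (Matrix.comp (Fin k) (Fin k) (Fin n) (Fin n) ℂ X).PosSemidef →
    (Matrix.comp (Fin k) (Fin k) (Fin n) (Fin n) ℂ (X.map F)).PosSemidef

theorem isCPMap_of_gramForm_nonneg {F : 𝕄 →ₗ[ℂ] 𝕄} (hs : ∀ x, F xᴴ = (F x)ᴴ)
    (hF : ∀ (k : ℕ) (ξ : Fin k → Fin n → ℂ) (a : Fin k → 𝕄), 0 ≤ gramForm F ξ a) : IsCPMap F := by
  intro k X hX
  obtain ⟨a, ha⟩ := exists_gram_of_posSemidef hX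
  refine Matrix.PosSemidef.of_dotProduct_mulVec_nonneg ?_ fun v => ?_
  · have h1 : ∀ i j, (X i j)ᴴ = X j i := fun i j => by
      rw [ha, ha, Matrix.conjTranspose_sum]
      simp
    ext ⟨i, c⟩ ⟨j, d⟩
    rw [Matrix.conjTranspose_apply, Matrix.comp_apply, Matrix.comp_apply, Matrix.map_apply,
      Matrix.map_apply, ← Matrix.conjTranspose_apply, ← hs, h1]
  · rw [dotProduct_comp_mulVec]
    have : ∑ i, ∑ j, star (fun c => v (i, c)) ⬝ᵥ (X.map F i j *ᵥ fun c => v (j, c)) =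
        ∑ l, gramForm F (fun i c => v (i, c)) (a l) := by
      simp only [gramForm, Matrix.map_apply, ha, map_sum, Matrix.sum_mulVec, dotProduct_sum]
      symm
      rw [Finset.sum_comm]
      exact Finset.sum_congr rfl fun i _ => Finset.sum_comm
    rw [this]
    exact Finset.sum_nonneg fun l _ => hF k _ _

theorem isCPMap_pow {F : Module.End ℂ 𝕄} (hF : IsCPMap F) (m : ℕ) : IsCPMap (F ^ m) := by
  induction m with
  | zero => exact fun k X hX => hX
  | succ m ih =>
    intro k X hX
    rw [pow_succ']
    exact hF k _ (ih k X hX)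

theorem isCPMap_of_tendsto {F : ℕ → 𝕄 →ₗ[ℂ] 𝕄} {F' : 𝕄 →ₗ[ℂ] 𝕄} (hF : ∀ m, IsCPMap (F m))
    (h : ∀ x, Tendsto (fun m => F m x) atTop (𝓝 (F' x))) : IsCPMap F' := by
  intro k X hX
  have hentry : ∀ i j c d, Tendsto (fun m => F m (X i j) c d) atTop (𝓝 (F' (X i j) c d)) :=
    fun i j c d => ((continuous_id.matrix_elem c d).tendsto _).comp (h (X i j))
  refine Matrix.PosSemidef.of_dotProduct_mulVec_nonneg ?_ fun v => ?_
  · ext ⟨i, c⟩ ⟨j, d⟩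
    refine tendsto_nhds_unique ?_ (hentry i j c d)
    refine ((continuous_star.tendsto _).comp (hentry j i d c)).congr fun m => ?_
    have := congrFun (congrFun (hF m k X hX).isHermitian (i, c)) (j, d)
    simpa using this
  · rw [dotProduct_comp_mulVec]
    have hlim : Tendsto (fun m => ∑ i, ∑ j, star (fun c => v (i, c)) ⬝ᵥ
        ((X.map (F m)) i j *ᵥ fun c => v (j, c))) atTop (𝓝 (∑ i, ∑ j, star (fun c => v (i, c)) ⬝ᵥ
        ((X.map F') i j *ᵥ fun c => v (j, c)))) := by
      refine tendsto_finsetSum _ fun i _ => tendsto_finsetSum _ fun j _ => ?_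
      have : Continuous fun A : 𝕄 => star (fun c => v (i, c)) ⬝ᵥ (A *ᵥ fun c => v (j, c)) := by
        fun_prop
      exact (this.tendsto _).comp (h (X i j))
    refine ge_of_tendsto' hlim fun m => ?_
    rw [← dotProduct_comp_mulVec]
    exact (hF m k X hX).dotProduct_mulVec_nonneg v

variable {M : StarSubalgebra ℂ (Matrix (Fin n) (Fin n) ℂ)}

theorem IsCompletelyPositive.posSemidef_gram {P : M →ₗ[ℂ] M} (hP : IsCompletelyPositive P) {k : ℕ}
    (a : Fin k → M) : (Matrix.comp (Fin k) (Fin k) (Fin n) (Fin n) ℂ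
      (Matrix.of fun i j => (P (star (a i) * a j) : 𝕄))).PosSemidef :=
  hP k (Matrix.of fun i j => star (a i) * a j) (posSemidef_comp_gram fun i => (a i : 𝕄))

/-- Two-positivity implies that a completely positive map preserves adjoints. -/
theorem IsCompletelyPositive.map_star {P : M →ₗ[ℂ] M} (hP : IsCompletelyPositive P) (x : M) :
    (P (star x) : 𝕄) = (P x : 𝕄)ᴴ := by
  have h := (hP.posSemidef_gram ![1, x]).isHermitian
  ext c d
  have := congrFun (congrFun h (1, c)) (0, d)
  rw [Matrix.conjTranspose_apply, Matrix.comp_apply, Matrix.comp_apply] at this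
  simpa using this.symm

end CompletePositivity

/-! ### Extension of the semigroup -/

section Assembly

theorem posDef_of_isDensityMatrix {σ : 𝕄} (hσ : IsDensityMatrix σ) (hrank : σ.rank = n) :
    σ.PosDef := by
  rw [hσ.posSemidef.posDef_iff_isUnit, ← Matrix.mulVec_surjective_iff_isUnit]
  have h : LinearMap.range σ.mulVecLin = ⊤ :=
    Submodule.eq_top_of_finrank_eq (by rw [← Matrix.rank, hrank]; simp)
  exact LinearMap.range_eq_top.1 h

theorem natCast_ne_zero_of_isDensityMatrix {σ : 𝕄} (hσ : IsDensityMatrix σ) : (n : ℂ) ≠ 0 := by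
  intro h
  have hn : n = 0 := by exact_mod_cast h
  subst hn
  have := hσ.trace_eq_one
  simp [Matrix.trace] at this

theorem gramForm_reindex (F : 𝕄 →ₗ[ℂ] 𝕄) {ι κ : Type} [Fintype ι] [Fintype κ] (e : κ ≃ ι)
    (ξ : ι → Fin n → ℂ) (a : ι → 𝕄) : gramForm F (ξ ∘ e) (a ∘ e) = gramForm F ξ a := by
  rw [gramForm, gramForm, ← Equiv.sum_comp e]
  refine Finset.sum_congr rfl fun i _ => ?_
  rw [← Equiv.sum_comp e]
  rfl

theorem gramForm_id {ι : Type} [Fintype ι] (ξ : ι → Fin n → ℂ) (a : ι → 𝕄) :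
    gramForm LinearMap.id ξ a = star (∑ i, a i *ᵥ ξ i) ⬝ᵥ ∑ i, a i *ᵥ ξ i := by
  rw [gramForm, star_sum, sum_dotProduct]
  refine Finset.sum_congr rfl fun i _ => ?_
  rw [star_mulVec_dotProduct, Matrix.mulVec_sum, dotProduct_sum]
  simp only [Matrix.mulVec_mulVec, LinearMap.id_apply]

section Extension

variable {M : StarSubalgebra ℂ (Matrix (Fin n) (Fin n) ℂ)} {S : Finset (Matrix (Fin n) (Fin n) ℂ)}
  (hS : IsStarBasis (Subalgebra.toSubmodule M.toSubalgebra) S)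

/-- A map on `M`, extended to all matrices by the identity on the orthogonal complement of `M`. -/
noncomputable def extendById (f : M →ₗ[ℂ] M) : Module.End ℂ 𝕄 :=
  (Subalgebra.toSubmodule M.toSubalgebra).subtype ∘ₗ f ∘ₗ
    (traceProj S).codRestrict (Subalgebra.toSubmodule M.toSubalgebra) hS.traceProj_mem +
      (LinearMap.id - traceProj S)

theorem extendById_apply (f : M →ₗ[ℂ] M) (x : 𝕄) : extendById hS f x =
    f ⟨traceProj S x, hS.traceProj_mem x⟩ + (x - traceProj S x) := rfl

theorem extendById_coe (f : M →ₗ[ℂ] M) (x : M) : extendById hS f x = f x := by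
  have : (⟨traceProj S x, hS.traceProj_mem x⟩ : M) = x := Subtype.ext (hS.traceProj_eq x.2)
  rw [extendById_apply, this, hS.traceProj_eq x.2, sub_self, add_zero]

theorem extendById_sub (f : M →ₗ[ℂ] M) (x : 𝕄) : extendById hS f x - x =
    f ⟨traceProj S x, hS.traceProj_mem x⟩ - traceProj S x := by
  rw [extendById_apply]; abel

theorem extendById_mul (f g : M →ₗ[ℂ] M) :
    extendById hS f * extendById hS g = extendById hS (f ∘ₗ g) := by
  refine LinearMap.ext fun x => ?_
  have h : traceProj S (extendById hS g x) = g ⟨traceProj S x, hS.traceProj_mem x⟩ := by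
    rw [extendById_apply, map_add, map_sub, hS.traceProj_eq (hS.traceProj_mem x), sub_self,
      add_zero, hS.traceProj_eq (Subtype.mem _)]
  have h' : (⟨traceProj S (extendById hS g x), hS.traceProj_mem _⟩ : M) =
      g ⟨traceProj S x, hS.traceProj_mem x⟩ := Subtype.ext h
  rw [Module.End.mul_apply, extendById_apply, h', h, extendById_apply hS g, extendById_apply,
    LinearMap.comp_apply]
  abel

/-- A detailed balance semigroup on `M` has a generator, which is a detailed balance generator. -/
theorem exists_detailedBalanceGenerator {σ : 𝕄} (hσM : σ ∈ M)
    {P : ℝ≥0 → M →ₗ[ℂ] M} (hP : IsQuantumMarkovSemigroup P) (hDBC : SatisfiesDBC σ P) :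
    ∃ (p : ℝ≥0 → Module.End ℂ 𝕄) (G : Module.End ℂ 𝕄), IsExpSemigroup G p ∧
      (∀ t (x : M), p t x = P t x) ∧ IsDetailedBalanceGenerator M σ G := by
  obtain ⟨S, hS⟩ := exists_isStarBasis_starSubalgebra M
  let E : 𝕄 → M := fun x => ⟨traceProj S x, hS.traceProj_mem x⟩
  obtain ⟨G, hG⟩ := exists_generator_of_matrix_semigroup (P := fun t => extendById hS (P t))
    (by
      rw [hP.zero]
      refine LinearMap.ext fun x => ?_
      rw [extendById_apply]
      simp)
    (fun s t => by rw [extendById_mul, hP.add])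
    (fun x => by
      have h1 := ((continuous_subtype_val.tendsto _).comp (hP.tendsto_zero (E x))).add_const
        (x - traceProj S x)
      simp only [E, add_sub_cancel] at h1
      exact h1)
  -- difference quotients
  let s : ℝ≥0 → Module.End ℂ 𝕄 := fun t => ((t : ℝ) : ℂ)⁻¹ • (extendById hS (P t) - 1)
  have hs : ∀ t x, s t x = ((t : ℝ) : ℂ)⁻¹ • ((P t (E x) : 𝕄) - traceProj S x) := fun t x => by
    rw [← extendById_sub]; rfl
  have hlim : ∀ x, Tendsto (fun t => s t x) (𝓝[>] 0) (𝓝 (G x)) := hG.tendsto_slope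
  have hsM : ∀ t (x : M), s t x = ((t : ℝ) : ℂ)⁻¹ • ((P t x : 𝕄) - x) := fun t x => by
    rw [← extendById_coe hS]; rfl
  refine ⟨_, G, hG, fun t x => extendById_coe hS _ x, ⟨?_, ?_, ?_, ?_, ?_⟩⟩
  · intro x
    have hcl : IsClosed ((Subalgebra.toSubmodule M.toSubalgebra : Submodule ℂ 𝕄) : Set 𝕄) :=
      Submodule.closed_of_finiteDimensional _
    refine hcl.mem_of_tendsto (hlim x) (Eventually.of_forall fun t => ?_)
    rw [hs]
    exact M.toSubalgebra.smul_mem (sub_mem (Subtype.mem _) (hS.traceProj_mem x)) _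
  · refine tendsto_nhds_unique (hlim 1) (tendsto_const_nhds.congr fun t => ?_)
    have := hsM t 1
    rw [hP.map_one, sub_self, smul_zero] at this
    exact this.symm
  · intro x
    refine tendsto_nhds_unique (hlim xᴴ) ?_
    refine ((continuous_id.matrix_conjTranspose.tendsto _).comp (hlim x)).congr fun t => ?_
    have : E xᴴ = star (E x) := Subtype.ext (hS.traceProj_conjTranspose x)
    simp only [Function.comp_apply, id]
    rw [hs, hs, this, (hP.completelyPositive t).map_star, hS.traceProj_conjTranspose,
      Matrix.conjTranspose_smul, Matrix.conjTranspose_sub]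
    simp
  · intro x y
    have hc1 : Continuous fun A : 𝕄 => (A * y * σ).trace :=
      ((continuous_id.mul continuous_const).mul continuous_const).matrix_trace
    have hc2 : Continuous fun A : 𝕄 => (x * A * σ).trace :=
      ((continuous_const.mul continuous_id).mul continuous_const).matrix_trace
    refine tendsto_nhds_unique ((hc1.tendsto _).comp (hlim x)) ?_
    refine ((hc2.tendsto _).comp (hlim y)).congr fun t => ?_
    simp only [Function.comp_apply]
    have h2 : ∀ b ∈ M, (b * y * σ).trace = (b * traceProj S y * σ).trace := fun b hb => by
      rw [Matrix.trace_mul_comm, ← Matrix.mul_assoc, ← hS.trace_mul_traceProj (mul_mem hσM hb),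
        Matrix.mul_assoc, Matrix.trace_mul_comm]
    have h3 : ∀ b ∈ M, (x * b * σ).trace = (traceProj S x * b * σ).trace := fun b hb => by
      rw [Matrix.mul_assoc, Matrix.trace_mul_comm, ← hS.trace_mul_traceProj (mul_mem hb hσM),
        Matrix.trace_mul_comm, Matrix.mul_assoc]
    have h4 := hDBC t (star (E x)) (E y)
    rw [(hP.completelyPositive t).map_star, Matrix.conjTranspose_conjTranspose] at h4
    have h5 : ((star (E x) : M) : 𝕄)ᴴ = traceProj S x := Matrix.conjTranspose_conjTranspose _
    rw [h5] at h4
    have h6 : (traceProj S x * y * σ).trace = (x * traceProj S y * σ).trace := by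
      rw [h2 _ (hS.traceProj_mem x), h3 _ (hS.traceProj_mem y)]
    rw [hs, hs]
    simp only [Matrix.smul_mul, Matrix.mul_smul, Matrix.trace_smul, sub_mul, mul_sub,
      Matrix.trace_sub]
    rw [h2 _ (Subtype.mem _), h3 _ (Subtype.mem _), h6, h4]
  · intro ι _ ξ a ha hξ
    have hgl : Tendsto (fun t => gramForm (s t) ξ a) (𝓝[>] 0) (𝓝 (gramForm G ξ a)) := by
      refine tendsto_finsetSum _ fun i _ => tendsto_finsetSum _ fun j _ => ?_
      have : Continuous fun A : 𝕄 => star (ξ i) ⬝ᵥ (A *ᵥ ξ j) := by fun_prop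
      exact (this.tendsto _).comp (hlim _)
    refine ge_of_tendsto' hgl fun t => ?_
    have h1 : gramForm (s t) ξ a = ((t : ℝ) : ℂ)⁻¹ * (gramForm (extendById hS (P t)) ξ a -
        gramForm LinearMap.id ξ a) := by
      simp only [gramForm, ← Finset.sum_sub_distrib, Finset.mul_sum]
      refine Finset.sum_congr rfl fun i _ => Finset.sum_congr rfl fun j _ => ?_
      rw [← dotProduct_sub, ← Matrix.sub_mulVec, ← smul_eq_mul (((t : ℝ) : ℂ)⁻¹), ← dotProduct_smul,
        ← Matrix.smul_mulVec]
      rfl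
    rw [h1, gramForm_id, hξ, star_zero, zero_dotProduct, sub_zero, ← Complex.ofReal_inv]
    refine mul_nonneg (by exact_mod_cast inv_nonneg.2 t.2) ?_
    let e := (Fintype.equivFin ι).symm
    rw [← gramForm_reindex _ e]
    have h2 := ((hP.completelyPositive t).posSemidef_gram
      fun i => (⟨a (e i), ha (e i)⟩ : M)).dotProduct_mulVec_nonneg fun q => ξ (e q.1) q.2
    rw [dotProduct_comp_mulVec] at h2
    refine h2.trans_eq (Finset.sum_congr rfl fun i _ => Finset.sum_congr rfl fun j _ => ?_)
    rw [Matrix.of_apply, ← extendById_coe hS]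
    rfl

end Extension

/-- The generator `x ↦ k x + x k + Ψ x` of a Lindblad form. -/
noncomputable def lindbladMap (k : 𝕄) (Ψ : 𝕄 →ₗ[ℂ] 𝕄) : Module.End ℂ 𝕄 :=
  LinearMap.mulLeft ℂ k + LinearMap.mulRight ℂ k + Ψ

theorem lindbladMap_apply (k : 𝕄) (Ψ : 𝕄 →ₗ[ℂ] 𝕄) (x : 𝕄) :
    lindbladMap k Ψ x = k * x + x * k + Ψ x := by simp [lindbladMap]

namespace IsDetailedBalanceForm

variable {σ k : Matrix (Fin n) (Fin n) ℂ}
  {Ψ : Matrix (Fin n) (Fin n) ℂ →ₗ[ℂ] Matrix (Fin n) (Fin n) ℂ}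
  {Q : ℝ≥0 → Module.End ℂ (Matrix (Fin n) (Fin n) ℂ)} (h : IsDetailedBalanceForm σ k Ψ)
include h

theorem lindbladMap_conjTranspose (x : 𝕄) : lindbladMap k Ψ xᴴ = (lindbladMap k Ψ x)ᴴ := by
  simp only [lindbladMap_apply, Matrix.conjTranspose_add, Matrix.conjTranspose_mul,
    h.conjTranspose_eq, h.map_conjTranspose]
  abel

theorem lindbladMap_symmetric (x y : 𝕄) :
    ((lindbladMap k Ψ x)ᴴ * y * σ).trace = (xᴴ * lindbladMap k Ψ y * σ).trace := by
  rw [← h.lindbladMap_conjTranspose]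
  simp only [lindbladMap_apply, add_mul, mul_add, Matrix.trace_add, h.symmetric]
  have h1 : (k * xᴴ * y * σ).trace = (xᴴ * (y * k) * σ).trace := by
    rw [Matrix.mul_assoc, Matrix.mul_assoc, Matrix.trace_mul_comm]
    simp only [Matrix.mul_assoc, h.comm]
  rw [h1, Matrix.mul_assoc xᴴ k]
  ring

/-- Euler approximations in product form, `x ↦ (1 + s k) x (1 + s k) + s Ψ x`, are completely
positive; hence so is the semigroup. -/
theorem isCPMap_exp (hQ : IsExpSemigroup (lindbladMap k Ψ) Q) (t : ℝ≥0) : IsCPMap (Q t) := by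
  refine isCPMap_of_tendsto (fun m => isCPMap_pow ?_ m)
    (hQ.tendsto_euler (LinearMap.mulLeft ℂ k ∘ₗ LinearMap.mulRight ℂ k) t)
  set r : ℝ := t / m with hr
  have hr0 : 0 ≤ r := by positivity
  set F : Module.End ℂ 𝕄 := 1 + (r : ℂ) • lindbladMap k Ψ +
    ((r ^ 2 : ℝ) : ℂ) • (LinearMap.mulLeft ℂ k ∘ₗ LinearMap.mulRight ℂ k) with hF
  set l : 𝕄 := 1 + (r : ℂ) • k with hl
  have hls : lᴴ = l := by
    rw [hl, Matrix.conjTranspose_add, Matrix.conjTranspose_one, Matrix.conjTranspose_smul,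
      h.conjTranspose_eq, Complex.star_def, Complex.conj_ofReal]
  have hFa : ∀ x, F x = l * x * l + (r : ℂ) • Ψ x := by
    intro x
    have e : F x = x + (r : ℂ) • lindbladMap k Ψ x + ((r ^ 2 : ℝ) : ℂ) • (k * (x * k)) := rfl
    rw [e, lindbladMap_apply, hl]
    simp only [add_mul, mul_add, Matrix.one_mul, Matrix.mul_one, Matrix.smul_mul, Matrix.mul_smul,
      Matrix.mul_assoc]
    push_cast
    module
  refine isCPMap_of_gramForm_nonneg (fun x => ?_) fun N ξ a => ?_
  · rw [hFa, hFa, h.map_conjTranspose, Matrix.conjTranspose_add, Matrix.conjTranspose_mul,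
      Matrix.conjTranspose_mul, Matrix.conjTranspose_smul, hls, Complex.star_def,
      Complex.conj_ofReal, Matrix.mul_assoc]
  · have e : gramForm F ξ a = gramForm LinearMap.id (fun i => l *ᵥ ξ i) a +
        (r : ℂ) * gramForm Ψ ξ a := by
      simp only [gramForm, Finset.mul_sum, ← Finset.sum_add_distrib]
      refine Finset.sum_congr rfl fun i _ => Finset.sum_congr rfl fun j _ => ?_
      rw [hFa, Matrix.add_mulVec, dotProduct_add, Matrix.smul_mulVec, dotProduct_smul,
        star_mulVec_dotProduct, hls, LinearMap.id_apply, Matrix.mulVec_mulVec, Matrix.mulVec_mulVec,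
        smul_eq_mul, Matrix.mul_assoc]
    rw [e, gramForm_id]
    exact add_nonneg (dotProduct_star_self_nonneg _)
      (mul_nonneg (by exact_mod_cast hr0) (h.gramForm_nonneg ξ a))

/-- Detailed balance passes from the generator to the semigroup. -/
theorem exp_symmetric (hQ : IsExpSemigroup (lindbladMap k Ψ) Q) (t : ℝ≥0) (x y : 𝕄) :
    ((Q t x)ᴴ * y * σ).trace = (xᴴ * Q t y * σ).trace := by
  have hstep : ∀ (r r' : ℝ) (x y : 𝕄),
      (((1 + (r : ℂ) • lindbladMap k Ψ + (r' : ℂ) • (0 : Module.End ℂ 𝕄)) x)ᴴ * y * σ).trace =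
      (xᴴ * (1 + (r : ℂ) • lindbladMap k Ψ + (r' : ℂ) • (0 : Module.End ℂ 𝕄)) y * σ).trace := by
    intro r r' x y
    simp only [smul_zero, add_zero, LinearMap.add_apply, LinearMap.smul_apply, Module.End.one_apply,
      Matrix.conjTranspose_add, Matrix.conjTranspose_smul, add_mul, mul_add, Matrix.trace_add,
      Matrix.smul_mul, Matrix.mul_smul, Matrix.trace_smul, h.lindbladMap_symmetric,
      Complex.star_def, Complex.conj_ofReal]
  have hpow : ∀ (r r' : ℝ) (m : ℕ) (x y : 𝕄),
      ((((1 + (r : ℂ) • lindbladMap k Ψ + (r' : ℂ) • (0 : Module.End ℂ 𝕄)) ^ m) x)ᴴ * y * σ).trace =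
      (xᴴ * ((1 + (r : ℂ) • lindbladMap k Ψ + (r' : ℂ) • (0 : Module.End ℂ 𝕄)) ^ m) y *
        σ).trace := by
    intro r r' m
    induction m with
    | zero => intro x y; simp
    | succ m ih =>
      intro x y
      conv_lhs => rw [pow_succ', Module.End.mul_apply, hstep, ih]
      rw [pow_succ, Module.End.mul_apply]
  have hc1 : Continuous fun A : 𝕄 => (Aᴴ * y * σ).trace :=
    ((continuous_id.matrix_conjTranspose.mul continuous_const).mul continuous_const).matrix_trace
  have hc2 : Continuous fun A : 𝕄 => (xᴴ * A * σ).trace :=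
    ((continuous_const.mul continuous_id).mul continuous_const).matrix_trace
  refine tendsto_nhds_unique ((hc1.tendsto _).comp (hQ.tendsto_euler 0 t x)) ?_
  exact ((hc2.tendsto _).comp (hQ.tendsto_euler 0 t y)).congr fun m => (hpow _ _ m x y).symm

end IsDetailedBalanceForm

/-- Semigroups agree on an invariant subalgebra on which their generators agree. -/
theorem IsExpSemigroup.eq_on {M : StarSubalgebra ℂ 𝕄} {G G' : Module.End ℂ 𝕄}
    {p Q : ℝ≥0 → Module.End ℂ 𝕄} (hp : IsExpSemigroup G p) (hQ : IsExpSemigroup G' Q)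
    (hG : ∀ x ∈ M, G x ∈ M) (hGG' : ∀ x ∈ M, G' x = G x) (t : ℝ≥0) {x : 𝕄} (hx : x ∈ M) :
    Q t x = p t x := by
  have hpow : ∀ (c : ℂ) (m : ℕ), ((1 + c • G) ^ m) x ∈ M ∧
      ((1 + c • G') ^ m) x = ((1 + c • G) ^ m) x := by
    intro c m
    induction m with
    | zero => exact ⟨hx, rfl⟩
    | succ m ih =>
      rw [pow_succ', pow_succ', Module.End.mul_apply, Module.End.mul_apply, ih.2]
      simp only [LinearMap.add_apply, Module.End.one_apply, LinearMap.smul_apply, hGG' _ ih.1]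
      exact ⟨add_mem ih.1 (M.toSubalgebra.smul_mem (hG _ ih.1) c), trivial⟩
  refine tendsto_nhds_unique (hQ.tendsto_euler 0 t x)
    ((hp.tendsto_euler 0 t x).congr fun m => ?_)
  rw [smul_zero, add_zero, add_zero]
  exact (hpow _ m).2.symm

/-- A linear map on matrices, viewed as a map on the full subalgebra. -/
def topEnd (f : Module.End ℂ 𝕄) :
    (⊤ : StarSubalgebra ℂ 𝕄) →ₗ[ℂ] (⊤ : StarSubalgebra ℂ 𝕄) where
  toFun x := ⟨f x, StarSubalgebra.mem_top⟩
  map_add' x y := Subtype.ext (map_add f (x : 𝕄) y)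
  map_smul' c x := Subtype.ext (map_smul f c (x : 𝕄))

theorem isQuantumMarkovSemigroup_topEnd {G : Module.End ℂ 𝕄} {Q : ℝ≥0 → Module.End ℂ 𝕄}
    (hQ : IsExpSemigroup G Q) (h1 : ∀ t, Q t 1 = 1) (hcp : ∀ t, IsCPMap (Q t)) :
    IsQuantumMarkovSemigroup fun t => topEnd (Q t) where
  map_one t := Subtype.ext (h1 t)
  completelyPositive t k X hX := hcp t k (X.map fun x => (x : 𝕄)) hX
  zero := LinearMap.ext fun x => Subtype.ext (by simp [topEnd, hQ.zero])
  add s t := LinearMap.ext fun x => Subtype.ext (by simp [topEnd, ← hQ.add])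
  tendsto_zero x := tendsto_subtype_rng.2 (hQ.tendsto_zero x)

end Assembly

end Matrices

theorem mainTheorem3 {n : ℕ} (M : StarSubalgebra ℂ (Matrix (Fin n) (Fin n) ℂ))
    (σ : Matrix (Fin n) (Fin n) ℂ) (hσM : σ ∈ M) (hσ : IsDensityMatrix σ) (hrank : σ.rank = n)
    (P : ℝ≥0 → M →ₗ[ℂ] M) (hP : IsQuantumMarkovSemigroup P) (hDBC : SatisfiesDBC σ P) :
    (∃ Phat : ℝ≥0 → (⊤ : StarSubalgebra ℂ (Matrix (Fin n) (Fin n) ℂ)) →ₗ[ℂ]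
          (⊤ : StarSubalgebra ℂ (Matrix (Fin n) (Fin n) ℂ)),
        IsQuantumMarkovSemigroup Phat ∧ SatisfiesDBC σ Phat ∧
        ∀ (t : ℝ≥0) (x : M),
          (Phat t ⟨(x : Matrix (Fin n) (Fin n) ℂ), StarSubalgebra.mem_top⟩ :
            Matrix (Fin n) (Fin n) ℂ) = P t x) ∧
    (∃ (m : ℕ) (ω c : Fin m → ℝ) (v : Fin m → Matrix (Fin n) (Fin n) ℂ),
        (∀ j, 0 < c j) ∧
        (∀ j, (v j).trace = 0) ∧
        (∀ j k, ((v j)ᴴ * v k).trace = if j = k then 1 else 0) ∧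
        (Set.range v = Set.range fun j => (v j)ᴴ) ∧
        (∀ j, σ * v j * σ⁻¹ = (Real.exp (-ω j) : ℂ) • v j) ∧
        ∃ L : M →ₗ[ℂ] M, IsGenerator P L ∧
          ∀ x : M, (L x : Matrix (Fin n) (Fin n) ℂ) =
            ∑ j, (c j : ℂ) •
              ((Real.exp (-ω j / 2) : ℂ) • ((v j)ᴴ * ⁅v j, (x : Matrix (Fin n) (Fin n) ℂ)⁆) -
                (Real.exp (ω j / 2) : ℂ) • (⁅v j, (x : Matrix (Fin n) (Fin n) ℂ)⁆ * (v j)ᴴ))) := by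
  have hpd := posDef_of_isDensityMatrix hσ hrank
  have hn := natCast_ne_zero_of_isDensityMatrix hσ
  obtain ⟨p, G, hG, hpP, hgen⟩ := exists_detailedBalanceGenerator hσM hP hDBC
  obtain ⟨k, Ψ, hform, hGk⟩ := hgen.exists_form hpd hσM
  obtain ⟨Q, hQ⟩ := exists_isExpSemigroup_matrix (lindbladMap k Ψ)
  have hQP : ∀ t (x : M), Q t x = P t x := fun t x => by
    rw [hG.eq_on hQ (fun x _ => hgen.map_mem x)
      (fun x hx => by rw [lindbladMap_apply, hGk x hx]) t x.2, hpP]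
  have h1 : k + k + Ψ 1 = 0 := by
    have := hGk 1 (one_mem M)
    rwa [hgen.map_one, Matrix.mul_one, Matrix.one_mul, eq_comm] at this
  refine ⟨⟨fun t => topEnd (Q t), isQuantumMarkovSemigroup_topEnd hQ (fun t => ?_)
    (hform.isCPMap_exp hQ), fun t x y => hform.exp_symmetric hQ t x y, hQP⟩, ?_⟩
  · have := hQP t 1
    rw [hP.map_one] at this
    exact this
  · obtain ⟨m, ω, c, v, hc, htr, ho, hr, hω, hx⟩ := hform.exists_alicki hn hpd h1
    refine ⟨m, ω, c, v, hc, htr, ho, hr, hω,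
      -(G.restrict (p := Subalgebra.toSubmodule M.toSubalgebra)
        (q := Subalgebra.toSubmodule M.toSubalgebra) fun x _ => hgen.map_mem x), ?_, ?_⟩
    · intro x
      refine tendsto_subtype_rng.2 ?_
      refine (hG.tendsto_slope x).neg.congr fun t => ?_
      rw [hpP, ← smul_neg, neg_sub]
      rfl
    · intro x
      rw [← hx, ← hGk x x.2]
      rfl
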